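/- For an integer $k$ and a positive integer $j$ let $$T_j(k)=\sum_{\substack{1\le i\le j\\ i\text{ odd}}}\binom ji\, i^k ,$$ a positive rational number with odd denominator (an integer if $k\ge 0$), and let $\nu$ denote the $2$-adic valuation on nonzero rational numbers. For an integer $k$ and a positive integer $n$ put $$\mathbf e(k,n)=\min\{\nu(T_j(k)) : j\ge n\}.$$ Theorem 1.1. Let $e$ be a positive integer. (a) If $e\ge 3$, then for every integer $k$ $$\mathbf e(k,2^e)\le 2^e+2^{e-1}-1,$$ with equality if and only if $k\equiv 2^e-1 \pmod{2^{2^{e-1}+e-1}}$. (b) If $e\ge 2$, then for every integer $k$ $$\mathbf e(k,2^e+1)\le 2^e+2^{e-1},$$ with equality if and only if $k\equiv 2^e+2^{2^{e-1}+e-1} \pmod{2^{2^{e-1}+e}}$. -/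

import Mathlib

/-- `T j k` is the sum over the odd `i` of `(j choose i) * i ^ k`. The exponent `k` is an arbitrary
integer, so the value is a rational number (with odd denominator). Only `i ≤ j` contribute. -/
def partialStirling (j : ℕ) (k : ℤ) : ℚ :=
  ∑ i ∈ (Finset.range (j + 1)).filter (fun i => Odd i), (j.choose i : ℚ) * (i : ℚ) ^ k

/-- `e(k, n)`: the minimum over `j ≥ n` of the 2-adic valuation of `T j k`.
The infimum is attained for `n ≥ 1`: see `minVal_isLeast`. -/
noncomputable def minVal (k : ℤ) (n : ℕ) : ℤ :=
  sInf {v : ℤ | ∃ j : ℕ, n ≤ j ∧ v = padicValRat 2 (partialStirling j k)}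

/-- No `T j k` with `j ≥ 1` vanishes, so the valuation is never the junk value at zero. -/
theorem partialStirling_pos {j : ℕ} (hj : 1 ≤ j) (k : ℤ) : 0 < partialStirling j k := by
  unfold partialStirling
  apply Finset.sum_pos
  · intro i hi
    simp only [Finset.mem_filter, Finset.mem_range] at hi
    have h1 : 0 < j.choose i := Nat.choose_pos (by omega)
    have h2 : 0 < i := hi.2.pos
    positivity
  · exact ⟨1, by simp; omega⟩

theorem padicValRat_partialStirling_nonneg {j : ℕ} (hj : 1 ≤ j) (k : ℤ) :
    0 ≤ padicValRat 2 (partialStirling j k) := by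
  have h : padicNorm 2 (partialStirling j k) ≤ 1 := by
    unfold partialStirling
    apply padicNorm.sum_le' _ zero_le_one
    intro i hi
    simp only [Finset.mem_filter, Finset.mem_range] at hi
    have h1 : padicNorm 2 (i : ℚ) = 1 := by
      rw [padicNorm.nat_eq_one_iff]
      exact hi.2.not_two_dvd_nat
    have h2 : padicNorm 2 ((i : ℚ) ^ k) = 1 := by
      have h0 : (i : ℚ) ≠ 0 := by exact_mod_cast hi.2.pos.ne'
      rw [padicNorm.eq_zpow_of_nonzero h0] at h1
      have h3 : padicValRat 2 (i : ℚ) = 0 := by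
        rw [padicValRat.of_nat, padicValNat.eq_zero_of_not_dvd hi.2.not_two_dvd_nat]
        rfl
      rw [padicNorm.eq_zpow_of_nonzero (zpow_ne_zero k h0), padicValRat.zpow, h3]
      simp
    rw [padicNorm.mul, h2, mul_one]
    exact padicNorm.of_nat _
  have h0 := (partialStirling_pos hj k).ne'
  rw [padicNorm.eq_zpow_of_nonzero h0] at h
  by_contra hneg
  have : (1 : ℚ) < (2 : ℚ) ^ (-padicValRat 2 (partialStirling j k)) :=
    one_lt_zpow₀ (by norm_num) (by omega)
  push_cast at h
  linarith

/-- For `n ≥ 1`, `minVal k n` is the least element of the set of valuations. -/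
theorem minVal_isLeast (k : ℤ) {n : ℕ} (hn : 1 ≤ n) :
    IsLeast {v : ℤ | ∃ j : ℕ, n ≤ j ∧ v = padicValRat 2 (partialStirling j k)} (minVal k n) := by
  have hb : BddBelow {v : ℤ | ∃ j : ℕ, n ≤ j ∧ v = padicValRat 2 (partialStirling j k)} := by
    refine ⟨0, ?_⟩
    rintro v ⟨j, hj, rfl⟩
    exact padicValRat_partialStirling_nonneg (hn.trans hj) k
  exact ⟨Int.csInf_mem ⟨_, n, le_rfl, rfl⟩ hb, fun v hv => csInf_le hb hv⟩

/-!
Write `n = 2 ^ e` and `N = n / 2 = 2 ^ (e - 1)`; in the lemmas below `e = h + 1`. A minimum of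
valuations is at least `t` if and only if `2 ^ t` divides all the `T j k` in question, so the proof
is about common divisors of these numbers.

*Reductions.* Since `i ^ k` is 2-adically continuous in `k` for odd `i`, the exponent may be taken
to be a natural number (`le_minVal_iff`). By Pascal's rule a number divides all `T j k`, `j ≥ n`,
if and only if it divides all the shifted sums
`oddSum ε n c k = ∑ l, (n choose (2 l + ε)) (2 (l + c) + 1) ^ k` with `ε = 0, 1` and `c ≥ 0`
(`forall_dvd_oddSum_iff`).

*Moments.* By Newton's forward difference formula everything is controlled by the moments
`∑ l, (n choose (2 l + ε)) (l choose r)`. The factorization `(1 + √t) ^ (2m) = ((1 + √t) ^ m) ^ 2`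
and the norm relation `E ^ 2 - t O ^ 2 = (1 - t) ^ m` for `(1 + √t) ^ m = E + √t O` give by
induction on `e` that `r!` times the `r`-th moment is divisible by `2 ^ (n - 1 - r)`, and by one
more factor 2 when `ε = 0` and `r ≠ 0, N` (`halfMoment_dvd`). So only the top term matters for
`ε = 0` modulo `2 ^ (N + 1)` (`halfSum_zero_modEq`).

*Change of exponent.* Expanding `(2 l + u) ^ d` binomially, a change of the exponent by `d` with
`ν(d) = e - 1 + b` changes the sums with `ε = 0` by exactly `2 ^ (n + b - 1)` modulo `2 ^ (n + b)`,
and those with `ε = 1` by a multiple of `2 ^ (n + b)` (`oddSum_zero_add_modEq`,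
`oddSum_one_add_modEq`); the difference comes from the single term of degree `N`.

*Base exponents.* For `κ < n` the vanishing of the `n`-th difference of `x ^ κ` turns `oddSum` at
`κ` into `2 ^ κ` times a sum `intSum` over all integers. The sums `intSum 1` are divisible by
`2 ^ N`. The sums `intSum 0` at `n` are, modulo `2 ^ (N + 1)`, the `N`-th differences of `x ^ κ`,
hence for `κ > N` again sums over odd integers, with `N` in place of `n`; since `κ` differs by `N`
from an exponent below `N`, the formulas for the change of exponent evaluate them
(`exists_intSum_zero_not_modEq`, `oddSum_double_modEq`).

Every `k` is `κ + d` with `κ` in a window of length `N` ending at `n - 1` (for part (a)) or at `n`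
(for part (b)) and `N ∣ d`. A `κ` below the end of the window gives a strictly smaller minimum; at
the end of the window comparing the sums at `κ` with the change caused by `d` yields the bound and
the case of equality.
-/

section

open Finset Polynomial

/-! ### Sums over one residue class modulo 2 -/

/-- The sum `∑ l, (n choose (2 l + ε)) f(l)` over one residue class modulo 2 of the lower index
(`ε = 0` or `1`). The range `l ≤ n` is generous: the binomial coefficient vanishes as soon as
`2 l + ε > n`. -/
def halfSum (ε n : ℕ) (f : ℕ → ℤ) : ℤ :=
  ∑ l ∈ range (n + 1), (n.choose (2 * l + ε) : ℤ) * f l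

theorem halfSum_eq_sum_range (ε : ℕ) {n m : ℕ} (h : n + 1 ≤ m) (f : ℕ → ℤ) :
    halfSum ε n f = ∑ l ∈ range m, (n.choose (2 * l + ε) : ℤ) * f l := by
  unfold halfSum
  apply sum_subset (by simpa using h)
  intro l _ hl
  rw [mem_range, not_lt] at hl
  rw [Nat.choose_eq_zero_of_lt (by omega)]
  simp

theorem halfSum_add (ε n : ℕ) (f g : ℕ → ℤ) :
    halfSum ε n (fun l => f l + g l) = halfSum ε n f + halfSum ε n g := by
  simp [halfSum, mul_add, sum_add_distrib]

theorem halfSum_sub (ε n : ℕ) (f g : ℕ → ℤ) :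
    halfSum ε n (fun l => f l - g l) = halfSum ε n f - halfSum ε n g := by
  simp [halfSum, mul_sub, sum_sub_distrib]

theorem halfSum_const_mul (ε n : ℕ) (a : ℤ) (f : ℕ → ℤ) :
    halfSum ε n (fun l => a * f l) = a * halfSum ε n f := by
  simp only [halfSum, mul_sum]
  exact sum_congr rfl fun _ _ => by ring

theorem halfSum_finset_sum {ι : Type*} (ε n : ℕ) (s : Finset ι) (f : ι → ℕ → ℤ) :
    halfSum ε n (fun l => ∑ i ∈ s, f i l) = ∑ i ∈ s, halfSum ε n (f i) := by
  simp only [halfSum, mul_sum]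
  exact sum_comm

theorem halfSum_one_succ (n : ℕ) (f : ℕ → ℤ) :
    halfSum 1 (n + 1) f = halfSum 1 n f + halfSum 0 n f := by
  rw [halfSum, halfSum_eq_sum_range 1 (show n + 1 ≤ n + 1 + 1 by omega),
    halfSum_eq_sum_range 0 (show n + 1 ≤ n + 1 + 1 by omega), ← sum_add_distrib]
  refine sum_congr rfl fun l _ => ?_
  rw [Nat.choose_succ_succ']
  push_cast
  rw [add_zero, add_comm, add_mul]

theorem halfSum_zero_succ (n : ℕ) (f : ℕ → ℤ) :
    halfSum 0 (n + 1) f = halfSum 0 n f + halfSum 1 n (fun l => f (l + 1)) := by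
  rw [halfSum, halfSum_eq_sum_range 0 (show n + 1 ≤ n + 1 + 1 by omega), halfSum,
    sum_range_succ', sum_range_succ' _ (n + 1)]
  have : ∀ l, ((n + 1).choose (2 * (l + 1) + 0) : ℤ) =
      n.choose (2 * (l + 1) + 0) + n.choose (2 * l + 1) := by
    intro l
    rw [show 2 * (l + 1) + 0 = 2 * l + 1 + 1 by ring, Nat.choose_succ_succ']
    push_cast
    ring
  simp only [this, add_mul, sum_add_distrib]
  simp only [mul_zero, add_zero, Nat.choose_zero_right]
  exact add_right_comm _ _ _

/-- The full alternating binomial sum is an iterated difference, so the two half sums determine each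
other up to that difference. -/
theorem halfSum_zero_sub_halfSum_one (n : ℕ) (g : ℕ → ℤ) :
    halfSum 0 n (fun l => g (2 * l)) - halfSum 1 n (fun l => g (2 * l + 1)) =
      (-1) ^ n * (fwdDiff 1)^[n] g 0 := by
  induction n generalizing g with
  | zero => simp [halfSum]
  | succ n ih =>
    have h0 := ih g
    have h1 := ih (fun l => g (l + 1))
    rw [halfSum_zero_succ, halfSum_one_succ, Function.iterate_succ_apply]
    have h2 : fwdDiff 1 g = (fun l => g (l + 1)) - g := rfl
    have h3 : (fwdDiff 1)^[n] ((fun l => g (l + 1)) - g) 0 =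
        (fwdDiff 1)^[n] (fun l => g (l + 1)) 0 - (fwdDiff 1)^[n] g 0 := by
      rw [sub_eq_add_neg, fwdDiff_iter_add, ← neg_one_smul ℤ g, fwdDiff_iter_const_smul]
      simp [sub_eq_add_neg]
    rw [h2, h3, pow_succ]
    linear_combination h0 - h1

/-- The binomial moments `∑ l, (n choose (2 l + ε)) (l choose r)`. -/
def halfMoment (ε n r : ℕ) : ℤ := halfSum ε n (fun l => (l.choose r : ℤ))

theorem halfMoment_eq_zero {ε n r : ℕ} (h : n < 2 * r + ε) : halfMoment ε n r = 0 := by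
  unfold halfMoment halfSum
  refine sum_eq_zero fun l _ => ?_
  rcases lt_or_ge l r with hl | hl
  · simp [Nat.choose_eq_zero_of_lt hl]
  · rw [Nat.choose_eq_zero_of_lt (by omega)]; simp

theorem halfMoment_top (m : ℕ) : halfMoment 0 (2 * m) m = 1 := by
  unfold halfMoment halfSum
  rw [sum_eq_single m]
  · simp
  · intro l _ hl
    rcases lt_or_gt_of_ne hl with hl | hl
    · simp [Nat.choose_eq_zero_of_lt hl]
    · rw [Nat.choose_eq_zero_of_lt (by omega)]; simp
  · simp; omega

/-- Newton's forward difference formula, summed against the binomial coefficients. -/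
theorem halfSum_eq_sum_fwdDiff (ε : ℕ) {n m : ℕ} (hm : n < 2 * m) (f : ℕ → ℤ) :
    halfSum ε n f = ∑ r ∈ range m, halfMoment ε n r * (fwdDiff 1)^[r] f 0 := by
  have hf : ∀ l ∈ range (n + 1), (n.choose (2 * l + ε) : ℤ) * f l =
      ∑ r ∈ range (n + 1 + m), (n.choose (2 * l + ε) : ℤ) *
        ((l.choose r : ℤ) * (fwdDiff 1)^[r] f 0) := by
    intro l hl
    rw [mem_range] at hl
    have h := shift_eq_sum_fwdDiff_iter (1 : ℕ) f l 0
    simp only [smul_eq_mul, mul_one, zero_add, nsmul_eq_mul] at h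
    rw [h, mul_sum]
    apply sum_subset (by simp; omega)
    intro r _ hr
    rw [mem_range, not_lt] at hr
    rw [Nat.choose_eq_zero_of_lt (show l < r by omega)]
    simp
  have h2 : ∑ r ∈ range m, halfMoment ε n r * (fwdDiff 1)^[r] f 0 =
      ∑ r ∈ range (n + 1 + m), halfMoment ε n r * (fwdDiff 1)^[r] f 0 := by
    apply sum_subset (by simp)
    intro r _ hr
    rw [mem_range, not_lt] at hr
    rw [halfMoment_eq_zero (by omega), zero_mul]
  rw [h2, halfSum, sum_congr rfl hf, sum_comm]
  refine sum_congr rfl fun r _ => ?_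
  rw [halfMoment, halfSum, sum_mul]
  exact sum_congr rfl fun l _ => by ring

/-! ### Differences of integer polynomials -/

/-- Leibniz rule for the differences of a product with a linear function. -/
theorem fwdDiff_iter_linear_mul (a b : ℤ) (f : ℕ → ℤ) (r y : ℕ) :
    (fwdDiff 1)^[r] (fun l : ℕ => (a * l + b) * f l) y =
      (a * (y + r) + b) * (fwdDiff 1)^[r] f y + a * r * (fwdDiff 1)^[r - 1] f y := by
  induction r generalizing f y b with
  | zero => simp
  | succ r ih =>
    have h1 : fwdDiff 1 (fun l : ℕ => (a * l + b) * f l) =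
        (fun l : ℕ => (a * l + (a + b)) * fwdDiff 1 f l) + a • f := by
      ext l
      simp [fwdDiff]
      ring
    rw [Function.iterate_succ_apply, h1, fwdDiff_iter_add, fwdDiff_iter_const_smul, Pi.add_apply,
      Pi.smul_apply, ih, Nat.add_sub_cancel]
    rcases r with _ | r
    · simp
      left
      ring
    · simp only [Nat.add_sub_cancel, ← Function.iterate_succ_apply, smul_eq_mul]
      push_cast
      ring

theorem fwdDiff_iter_linear_pow_eq_zero (a b : ℤ) {m r : ℕ} (h : m < r) (y : ℕ) :
    (fwdDiff 1)^[r] (fun l : ℕ => (a * l + b) ^ m) y = 0 := by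
  induction m generalizing r y with
  | zero =>
    obtain ⟨r, rfl⟩ := Nat.exists_eq_succ_of_ne_zero h.ne'
    rw [Function.iterate_succ_apply]
    have : fwdDiff 1 (fun l : ℕ => (a * l + b) ^ 0) = (0 : ℤ) • (fun _ : ℕ => (0 : ℤ)) := by
      ext; simp [fwdDiff]
    rw [this, fwdDiff_iter_const_smul]
    simp
  | succ m ih =>
    simp only [pow_succ']
    rw [fwdDiff_iter_linear_mul, ih (by omega), ih (by omega)]
    simp

theorem fwdDiff_iter_linear_pow_self (a b : ℤ) (m y : ℕ) :
    (fwdDiff 1)^[m] (fun l : ℕ => (a * l + b) ^ m) y = a ^ m * m.factorial := by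
  induction m generalizing y with
  | zero => simp
  | succ m ih =>
    simp only [pow_succ']
    rw [fwdDiff_iter_linear_mul, fwdDiff_iter_linear_pow_eq_zero a b (Nat.lt_succ_self m),
      Nat.add_sub_cancel, ih, Nat.factorial_succ]
    push_cast
    ring

/-- The `r`-th difference of an integer polynomial in `a * l + b` is divisible by `a ^ r * r!`. -/
theorem pow_mul_factorial_dvd_fwdDiff_iter (a b : ℤ) (p : ℤ[X]) (r y : ℕ) :
    a ^ r * r.factorial ∣ (fwdDiff 1)^[r] (fun l : ℕ => p.eval (a * l + b)) y := by
  induction p using Polynomial.induction_on generalizing r y with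
  | C c =>
    rcases r with _ | r
    · simp
    · have := fwdDiff_iter_linear_pow_eq_zero a b (Nat.succ_pos r) y
      have h : (fun l : ℕ => (C c).eval (a * l + b)) = c • fun l : ℕ => (a * l + b) ^ 0 := by
        ext; simp
      rw [h, fwdDiff_iter_const_smul, Pi.smul_apply, this]
      simp
  | add p q hp hq =>
    have h : (fun l : ℕ => (p + q).eval (a * l + b)) =
        (fun l : ℕ => p.eval (a * l + b)) + fun l : ℕ => q.eval (a * l + b) := by
      ext; simp
    rw [h, fwdDiff_iter_add]
    exact dvd_add (hp r y) (hq r y)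
  | monomial m c hp =>
    have h : (fun l : ℕ => (C c * X ^ (m + 1)).eval (a * l + b)) =
        fun l : ℕ => (a * l + b) * (C c * X ^ m).eval (a * l + b) := by
      ext; simp; ring
    rw [h, fwdDiff_iter_linear_mul]
    refine dvd_add (Dvd.dvd.mul_left (hp r y) _) ?_
    rcases r with _ | r
    · simp
    · obtain ⟨q, hq⟩ := hp r y
      rw [Nat.add_sub_cancel, hq, Nat.factorial_succ]
      exact ⟨q, by push_cast; ring⟩

/-! ### 2-divisibility of the binomial moments -/

theorem halfMoment_one_succ (n r : ℕ) :
    halfMoment 1 (n + 1) r = halfMoment 1 n r + halfMoment 0 n r :=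
  halfSum_one_succ n _

theorem halfMoment_zero_succ_zero (n : ℕ) :
    halfMoment 0 (n + 1) 0 = halfMoment 0 n 0 + halfMoment 1 n 0 := by
  unfold halfMoment
  rw [halfSum_zero_succ]
  simp

theorem halfMoment_zero_succ_succ (n r : ℕ) :
    halfMoment 0 (n + 1) (r + 1) =
      halfMoment 0 n (r + 1) + (halfMoment 1 n (r + 1) + halfMoment 1 n r) := by
  unfold halfMoment
  rw [halfSum_zero_succ, ← halfSum_add]
  congr 2
  ext l
  rw [Nat.choose_succ_succ']
  push_cast
  ring

/-- The generating series of the binomial moments. As polynomials in `t = 1 + X`, the two series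
`E = momentSeries 0 n` and `O = momentSeries 1 n` are the two halves of
`(1 + √t) ^ n = E + √t * O`. -/
noncomputable def momentSeries (ε n : ℕ) : PowerSeries ℤ := PowerSeries.mk (halfMoment ε n)

theorem momentSeries_zero_succ (n : ℕ) :
    momentSeries 0 (n + 1) = momentSeries 0 n + (1 + PowerSeries.X) * momentSeries 1 n := by
  ext r
  rcases r with _ | r
  · simp [momentSeries, halfMoment_zero_succ_zero, add_mul]
  · simp [momentSeries, halfMoment_zero_succ_succ, add_mul, PowerSeries.coeff_succ_X_mul]

theorem momentSeries_one_succ (n : ℕ) :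
    momentSeries 1 (n + 1) = momentSeries 0 n + momentSeries 1 n := by
  ext r
  simp [momentSeries, halfMoment_one_succ, add_comm]

theorem momentSeries_zero_zero : momentSeries 0 0 = 1 := by
  ext r
  rcases r with _ | r <;> simp [momentSeries, halfMoment, halfSum]

theorem momentSeries_one_zero : momentSeries 1 0 = 0 := by
  ext r
  simp [momentSeries, halfMoment, halfSum]

theorem momentSeries_add (m k : ℕ) :
    momentSeries 0 (m + k) = momentSeries 0 m * momentSeries 0 k +
        (1 + PowerSeries.X) * (momentSeries 1 m * momentSeries 1 k) ∧
      momentSeries 1 (m + k) =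
        momentSeries 0 m * momentSeries 1 k + momentSeries 1 m * momentSeries 0 k := by
  induction m with
  | zero => simp [momentSeries_zero_zero, momentSeries_one_zero]
  | succ m ih =>
    rw [show m + 1 + k = m + k + 1 by ring, momentSeries_zero_succ (m + k),
      momentSeries_one_succ (m + k), momentSeries_zero_succ m, momentSeries_one_succ m, ih.1, ih.2]
    constructor <;> ring

/-- The norm of `(1 + √t) ^ n` is `(1 - t) ^ n`. -/
theorem momentSeries_norm (n : ℕ) :
    momentSeries 0 n ^ 2 - (1 + PowerSeries.X) * momentSeries 1 n ^ 2 = (-PowerSeries.X) ^ n := by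
  induction n with
  | zero => simp [momentSeries_zero_zero, momentSeries_one_zero]
  | succ n ih =>
    rw [momentSeries_zero_succ, momentSeries_one_succ, pow_succ (-PowerSeries.X), ← ih]
    ring

theorem momentSeries_zero_double (m : ℕ) :
    momentSeries 0 (2 * m) = 2 * (momentSeries 0 m * momentSeries 0 m) - (-PowerSeries.X) ^ m := by
  rw [two_mul, (momentSeries_add m m).1, ← momentSeries_norm m]
  ring

theorem momentSeries_one_double (m : ℕ) :
    momentSeries 1 (2 * m) = 2 * (momentSeries 0 m * momentSeries 1 m) := by
  rw [two_mul, (momentSeries_add m m).2]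
  ring

/-- The product of power series, in terms of the exponential coefficients. -/
theorem factorial_mul_coeff_mul (F G : PowerSeries ℤ) (r : ℕ) :
    (r.factorial : ℤ) * (F * G).coeff r = ∑ i ∈ range (r + 1), (r.choose i : ℤ) *
      ((i.factorial * F.coeff i) * ((r - i).factorial * G.coeff (r - i))) := by
  rw [PowerSeries.coeff_mul, Finset.Nat.sum_antidiagonal_eq_sum_range_succ
    (fun i j => F.coeff i * G.coeff j), mul_sum]
  refine sum_congr rfl fun i hi => ?_
  rw [mem_range] at hi
  rw [← Nat.choose_mul_factorial_mul_factorial (show i ≤ r by omega)]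
  push_cast
  ring

/-- Divisibility of a term of twice a product, in the form in which it occurs after
`factorial_mul_coeff_mul`. -/
theorem two_mul_dvd_of_pow_dvd {a b s c : ℕ} {x y : ℤ} (hx : 2 ^ a ∣ x) (hy : 2 ^ b ∣ y)
    (h : s ≤ a + b + 1) : 2 ^ s ∣ 2 * ((c : ℤ) * (x * y)) := by
  refine (pow_dvd_pow 2 h).trans ?_
  obtain ⟨x, rfl⟩ := hx
  obtain ⟨y, rfl⟩ := hy
  exact ⟨c * (x * y), by ring⟩

/-- `(2 ^ h)!` has 2-adic valuation `2 ^ h - 1`. -/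
theorem exists_odd_factorial_two_pow (h : ℕ) :
    ∃ q : ℤ, Odd q ∧ ((2 ^ h).factorial : ℤ) = 2 ^ (2 ^ h - 1) * q := by
  have : Fact (Nat.Prime 2) := ⟨Nat.prime_two⟩
  have h1 := sub_one_mul_padicValNat_factorial (p := 2) (2 ^ h)
  have h2 : (Nat.digits 2 (2 ^ h)).sum = 1 := by
    have := Nat.digits_base_pow_mul (b := 2) (k := h) (m := 1) (by norm_num) (by norm_num)
    rw [mul_one] at this
    rw [this]
    simp
  rw [h2] at h1
  rw [show (2 - 1 : ℕ) = 1 from rfl, one_mul] at h1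
  obtain ⟨q, hq⟩ := pow_padicValNat_dvd (p := 2) (n := (2 ^ h).factorial)
  have h3 := pow_succ_padicValNat_not_dvd (p := 2) (Nat.factorial_ne_zero (2 ^ h))
  rw [h1] at hq h3
  refine ⟨q, ?_, by exact_mod_cast hq⟩
  rw [Int.odd_coe_nat, ← Nat.not_even_iff_odd, even_iff_two_dvd]
  rintro ⟨c, rfl⟩
  exact h3 ⟨c, by rw [hq]; ring⟩

/-- For `n = 2 ^ k` the number `r! * halfMoment ε n r` is divisible by `2 ^ (n - 1 - r)`, and for
`ε = 0` by one more factor 2 except at `r = 0` and `r = n / 2`. The exponents are truncated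
differences. The induction on `k` uses the doubling formulas for `momentSeries`. -/
theorem halfMoment_dvd (k : ℕ) :
    (∀ r, (2 : ℤ) ^ (2 ^ k - 1 - r) ∣ r.factorial * halfMoment 0 (2 ^ k) r) ∧
    (∀ r, 0 < r → 2 * r ≠ 2 ^ k → (2 : ℤ) ^ (2 ^ k - r) ∣ r.factorial * halfMoment 0 (2 ^ k) r) ∧
    (∀ r, (2 : ℤ) ^ (2 ^ k - 1 - r) ∣ r.factorial * halfMoment 1 (2 ^ k) r) := by
  have hc : ∀ ε n r, halfMoment ε n r = (momentSeries ε n).coeff r := fun ε n r => by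
    simp [momentSeries]
  simp only [hc]
  induction k with
  | zero =>
    refine ⟨by simp, fun r hr hr' => ?_, by simp⟩
    rw [show 2 ^ 0 - r = 0 by simp; omega]
    simp
  | succ k ih =>
    obtain ⟨ih1, ih2, ih3⟩ := ih
    have hm : 0 < 2 ^ k := by positivity
    rw [pow_succ', momentSeries_zero_double, momentSeries_one_double]
    have h2 : ∀ F : PowerSeries ℤ, ∀ r, (2 * F).coeff r = 2 * F.coeff r := fun F r => by
      rw [two_mul, map_add, two_mul]
    have hX : ∀ m r : ℕ, ((-PowerSeries.X : PowerSeries ℤ) ^ m).coeff r =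
        if r = m then (-1) ^ m else 0 := by
      intro m r
      rw [neg_pow, ← map_one (PowerSeries.C (R := ℤ)), ← map_neg, ← map_pow,
        PowerSeries.coeff_C_mul, PowerSeries.coeff_X_pow]
      split_ifs <;> simp
    set m := 2 ^ k with hmdef
    refine ⟨fun r => ?_, fun r hr0 hr => ?_, fun r => ?_⟩
    · rw [map_sub, h2, mul_sub, mul_left_comm, factorial_mul_coeff_mul, mul_sum, hX]
      refine dvd_sub (dvd_sum fun i hi => ?_) ?_
      · rw [mem_range] at hi
        exact two_mul_dvd_of_pow_dvd (ih1 i) (ih1 (r - i)) (by omega)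
      · split_ifs with h
        · subst h
          obtain ⟨q, -, hq⟩ := exists_odd_factorial_two_pow k
          rw [← hmdef] at hq
          rw [hq, show 2 * m - 1 - m = m - 1 by omega, mul_assoc]
          exact dvd_mul_right _ _
        · simp
    · rw [map_sub, h2, mul_sub, mul_left_comm, factorial_mul_coeff_mul, hX,
        if_neg (by omega), mul_zero, sub_zero]
      obtain ⟨s, rfl⟩ := Nat.exists_eq_succ_of_ne_zero hr0.ne'
      rw [sum_range_succ, sum_range_succ', add_assoc, mul_add, mul_sum]
      refine dvd_add (dvd_sum fun i hi => ?_) ?_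
      · rw [mem_range] at hi
        by_cases h1 : 2 * (i + 1) = m
        · exact two_mul_dvd_of_pow_dvd (ih1 (i + 1)) (ih2 (s + 1 - (i + 1)) (by omega) (by omega))
            (by omega)
        · exact two_mul_dvd_of_pow_dvd (ih2 (i + 1) (by omega) h1) (ih1 (s + 1 - (i + 1)))
            (by omega)
      · -- the two extreme terms coincide, which gains a factor 2
        obtain ⟨x, hx⟩ := ih1 0
        obtain ⟨y, hy⟩ := ih1 (s + 1)
        simp only [Nat.succ_eq_add_one, Nat.sub_zero, Nat.sub_self, hx, hy]
        have : 2 * m - (s + 1) ≤ 2 + (m - 1) + (m - 1 - (s + 1)) := by omega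
        refine (pow_dvd_pow 2 this).trans ⟨x * y, ?_⟩
        simp
        ring
    · rw [h2, mul_left_comm, factorial_mul_coeff_mul, mul_sum]
      refine dvd_sum fun i hi => ?_
      rw [mem_range] at hi
      exact two_mul_dvd_of_pow_dvd (ih1 i) (ih3 (r - i)) (by omega)

/-! ### Half sums of integer polynomials -/

/-- Evaluating at even integers gains `2 ^ r` in the `r`-th difference, which makes up for the loss
in the `r`-th moment: the half sums are divisible by `2 ^ (n - 1)`. -/
theorem two_pow_dvd_halfSum_two_mul {ε : ℕ} (hε : ε ≤ 1) (k : ℕ) (p : ℤ[X]) :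
    (2 : ℤ) ^ (2 ^ k - 1) ∣ halfSum ε (2 ^ k) (fun l => p.eval (2 * l : ℤ)) := by
  rw [halfSum_eq_sum_fwdDiff ε (show 2 ^ k < 2 * 2 ^ k by
    have : 0 < 2 ^ k := by positivity
    omega)]
  refine dvd_sum fun r _ => ?_
  have h1 : (2 : ℤ) ^ (2 ^ k - 1 - r) ∣ r.factorial * halfMoment ε (2 ^ k) r := by
    interval_cases ε
    · exact (halfMoment_dvd k).1 r
    · exact (halfMoment_dvd k).2.2 r
  obtain ⟨x, hx⟩ := h1
  have h2 := pow_mul_factorial_dvd_fwdDiff_iter 2 0 p r 0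
  simp only [add_zero] at h2
  obtain ⟨y, hy⟩ := h2
  refine (pow_dvd_pow 2 (show 2 ^ k - 1 ≤ (2 ^ k - 1 - r) + r by omega)).trans ⟨x * y, ?_⟩
  rw [hy, pow_add]
  linear_combination 2 ^ r * y * hx

theorem factorial_dvd_fwdDiff_iter (p : ℤ[X]) (r y : ℕ) :
    (r.factorial : ℤ) ∣ (fwdDiff 1)^[r] (fun l : ℕ => p.eval (l : ℤ)) y := by
  simpa using pow_mul_factorial_dvd_fwdDiff_iter 1 0 p r y

/-- The odd half sums at `n = 2 ^ (h + 1)`, divisible by `2 ^ (n / 2)`. -/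
theorem two_pow_dvd_halfSum_one (h : ℕ) (p : ℤ[X]) :
    (2 : ℤ) ^ 2 ^ h ∣ halfSum 1 (2 ^ (h + 1)) (fun l => p.eval (l : ℤ)) := by
  rw [halfSum_eq_sum_fwdDiff 1 (show 2 ^ (h + 1) < 2 * (2 ^ h + 1) by rw [pow_succ]; omega)]
  refine dvd_sum fun r hr => ?_
  rw [mem_range] at hr
  rcases (show r < 2 ^ h ∨ r = 2 ^ h by omega) with hr | rfl
  · obtain ⟨x, hx⟩ := (halfMoment_dvd (h + 1)).2.2 r
    obtain ⟨y, hy⟩ := factorial_dvd_fwdDiff_iter p r 0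
    refine (pow_dvd_pow 2 (show 2 ^ h ≤ 2 ^ (h + 1) - 1 - r by rw [pow_succ]; omega)).trans
      ⟨x * y, ?_⟩
    rw [hy]
    linear_combination y * hx
  · rw [halfMoment_eq_zero (by rw [pow_succ]; omega), zero_mul]
    exact dvd_zero _

/-- Only the top term of Newton's formula contributes to the even half sums at `n = 2 ^ (h + 1)`
modulo `2 ^ (n / 2 + 1)`. -/
theorem halfSum_zero_modEq {h : ℕ} (hh : 1 ≤ h) (p : ℤ[X]) :
    halfSum 0 (2 ^ (h + 1)) (fun l => p.eval (l : ℤ)) ≡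
      (fwdDiff 1)^[2 ^ h] (fun l : ℕ => p.eval (l : ℤ)) 0 [ZMOD 2 ^ (2 ^ h + 1)] := by
  have hN : 2 ≤ 2 ^ h := by simpa using Nat.pow_le_pow_right (n := 2) (by norm_num) hh
  rw [halfSum_eq_sum_fwdDiff 0 (show 2 ^ (h + 1) < 2 * (2 ^ h + 1) by rw [pow_succ]; omega),
    sum_range_succ, show halfMoment 0 (2 ^ (h + 1)) (2 ^ h) = 1 by
      rw [pow_succ']; exact halfMoment_top _, one_mul]
  refine Int.ModEq.symm ((Int.modEq_iff_dvd).2 ?_)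
  rw [add_sub_cancel_right]
  refine dvd_sum fun r hr => ?_
  rw [mem_range] at hr
  obtain ⟨y, hy⟩ := factorial_dvd_fwdDiff_iter p r 0
  have h1 : (2 : ℤ) ^ (2 ^ h + 1) ∣ r.factorial * halfMoment 0 (2 ^ (h + 1)) r := by
    rcases Nat.eq_zero_or_pos r with rfl | h0
    · exact (pow_dvd_pow 2 (by rw [pow_succ]; omega)).trans ((halfMoment_dvd (h + 1)).1 0)
    · exact (pow_dvd_pow 2 (by rw [pow_succ]; omega)).trans
        ((halfMoment_dvd (h + 1)).2.1 r h0 (by rw [pow_succ]; omega))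
  obtain ⟨x, hx⟩ := h1
  refine ⟨x * y, ?_⟩
  rw [hy]
  linear_combination y * hx

theorem two_pow_dvd_halfSum_zero {h : ℕ} (hh : 1 ≤ h) (p : ℤ[X]) :
    (2 : ℤ) ^ (2 ^ h - 1) ∣ halfSum 0 (2 ^ (h + 1)) (fun l => p.eval (l : ℤ)) := by
  have h1 := (halfSum_zero_modEq hh p).symm.dvd
  obtain ⟨q, -, hq⟩ := exists_odd_factorial_two_pow h
  have h2 := factorial_dvd_fwdDiff_iter p (2 ^ h) 0
  rw [hq] at h2
  have h3 := dvd_add ((pow_dvd_pow 2 ((Nat.sub_le _ _).trans (Nat.le_succ _))).trans h1)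
    (dvd_of_mul_right_dvd h2)
  rwa [sub_add_cancel] at h3

theorem halfMoment_zero_zero (n : ℕ) : halfMoment 0 (n + 1) 0 = 2 ^ n ∧
    halfMoment 1 (n + 1) 0 = 2 ^ n := by
  induction n with
  | zero => simp [halfMoment, halfSum, sum_range_succ, Nat.choose_eq_zero_of_lt]
  | succ n ih =>
    rw [halfMoment_zero_succ_zero, halfMoment_one_succ (n + 1), ih.1, ih.2, pow_succ]
    constructor <;> ring

/-! ### Shifted power sums -/

/-- The shifted power sums over odd numbers, `∑ l, (n choose (2 l + ε)) (2 (l + c) + 1) ^ κ`. -/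
def oddSum (ε n c κ : ℕ) : ℤ := halfSum ε n (fun l => (2 * ((l + c : ℕ) : ℤ) + 1) ^ κ)

/-- The shifted power sums `∑ l, (n choose (2 l + ε)) (l + c) ^ κ`. -/
def intSum (ε n c κ : ℕ) : ℤ := halfSum ε n (fun l => ((l + c : ℕ) : ℤ) ^ κ)

theorem intSum_eq_eval (ε n c κ : ℕ) :
    intSum ε n c κ = halfSum ε n (fun l => ((X + C (c : ℤ)) ^ κ : ℤ[X]).eval (l : ℤ)) := by
  simp [intSum]

theorem oddSum_eq_eval (ε n c κ : ℕ) : oddSum ε n c κ =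
    halfSum ε n (fun l => ((X + C (2 * c + 1 : ℤ)) ^ κ : ℤ[X]).eval (2 * l : ℤ)) := by
  unfold oddSum
  congr 1
  ext l
  simp only [eval_pow, eval_add, eval_X, eval_C]
  push_cast
  ring

theorem two_pow_dvd_oddSum {ε : ℕ} (hε : ε ≤ 1) (k c κ : ℕ) :
    (2 : ℤ) ^ (2 ^ k - 1) ∣ oddSum ε (2 ^ k) c κ := by
  rw [oddSum_eq_eval]
  exact two_pow_dvd_halfSum_two_mul hε k _

theorem two_pow_dvd_intSum_one (h c κ : ℕ) : (2 : ℤ) ^ 2 ^ h ∣ intSum 1 (2 ^ (h + 1)) c κ := by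
  rw [intSum_eq_eval]
  exact two_pow_dvd_halfSum_one h _

theorem two_pow_dvd_intSum_zero {h : ℕ} (hh : 1 ≤ h) (c κ : ℕ) :
    (2 : ℤ) ^ (2 ^ h - 1) ∣ intSum 0 (2 ^ (h + 1)) c κ := by
  rw [intSum_eq_eval]
  exact two_pow_dvd_halfSum_zero hh _

theorem intSum_zero_modEq {h : ℕ} (hh : 1 ≤ h) (c κ : ℕ) : intSum 0 (2 ^ (h + 1)) c κ ≡
    (fwdDiff 1)^[2 ^ h] (fun l : ℕ => (l : ℤ) ^ κ) c [ZMOD 2 ^ (2 ^ h + 1)] := by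
  have h1 := halfSum_zero_modEq hh ((X + C (c : ℤ)) ^ κ)
  rw [← intSum_eq_eval] at h1
  have h2 := fwdDiff_iter_comp_add (1 : ℕ) (fun l : ℕ => (l : ℤ) ^ κ) c (2 ^ h) 0
  rw [zero_add] at h2
  rw [← h2]
  simpa using h1

theorem odd_iff_modEq_one {u : ℤ} : Odd u ↔ u ≡ 1 [ZMOD 2] := by
  rw [Int.odd_iff]; rfl

theorem two_pow_mul_odd_modEq {u : ℤ} (hu : Odd u) (s : ℕ) :
    2 ^ s * u ≡ 2 ^ s [ZMOD 2 ^ (s + 1)] := by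
  obtain ⟨v, rfl⟩ := hu
  exact (Int.modEq_iff_dvd.2 ⟨-v, by ring⟩)

/-- For small exponents only the constant term contributes. -/
theorem oddSum_zero_modEq_of_lt {h c κ : ℕ} (hκ : κ < 2 ^ h) :
    oddSum 0 (2 ^ (h + 1)) c κ ≡ 2 ^ (2 ^ (h + 1) - 1) [ZMOD 2 ^ 2 ^ (h + 1)] := by
  have hN : 0 < 2 ^ h := by positivity
  have hn : 2 ^ (h + 1) - 1 + 1 = 2 ^ (h + 1) := by rw [pow_succ]; omega
  rw [oddSum, halfSum_eq_sum_fwdDiff 0 (show 2 ^ (h + 1) < 2 * (2 ^ h + 1) by rw [pow_succ]; omega),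
    sum_range_succ']
  have h1 : ∀ r ∈ range (2 ^ h), (2 : ℤ) ^ 2 ^ (h + 1) ∣ halfMoment 0 (2 ^ (h + 1)) (r + 1) *
      (fwdDiff 1)^[r + 1] (fun l => (2 * ((l + c : ℕ) : ℤ) + 1) ^ κ) 0 := by
    intro r hr
    rw [mem_range] at hr
    have h2 : (fun l : ℕ => (2 * ((l + c : ℕ) : ℤ) + 1) ^ κ) =
      fun l : ℕ => (X ^ κ : ℤ[X]).eval (2 * (l : ℤ) + (2 * c + 1)) := by
      ext l
      simp only [eval_pow, eval_X]
      push_cast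
      ring
    rw [h2]
    rcases lt_or_ge κ (r + 1) with hlt | hge
    · have := fwdDiff_iter_linear_pow_eq_zero 2 (2 * c + 1) hlt 0
      simp only [eval_pow, eval_X]
      rw [this, mul_zero]
      exact dvd_zero _
    · obtain ⟨y, hy⟩ := pow_mul_factorial_dvd_fwdDiff_iter 2 (2 * c + 1) (X ^ κ) (r + 1) 0
      obtain ⟨x, hx⟩ := (halfMoment_dvd (h + 1)).2.1 (r + 1) (by omega) (by rw [pow_succ]; omega)
      have hle : 2 ^ (h + 1) ≤ 2 ^ (h + 1) - (r + 1) + (r + 1) := by omega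
      refine (pow_dvd_pow 2 hle).trans ⟨x * y, ?_⟩
      rw [hy, pow_add (2 : ℤ)]
      linear_combination 2 ^ (r + 1) * y * hx
  have h3 := (Int.modEq_zero_iff_dvd.2 (dvd_sum h1)).add_right (halfMoment 0 (2 ^ (h + 1)) 0 *
      (fwdDiff 1)^[0] (fun l => (2 * ((l + c : ℕ) : ℤ) + 1) ^ κ) 0)
  refine h3.trans ?_
  rw [zero_add, ← hn, (halfMoment_zero_zero _).1, Nat.add_sub_cancel]
  refine two_pow_mul_odd_modEq ?_ _
  simp only [Function.iterate_zero, id_eq]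
  exact Odd.pow ⟨_, rfl⟩

theorem two_pow_dvd_intSum_zero_of_lt {h κ : ℕ} (h0 : 0 < κ) (hκ : κ < 2 ^ h) :
    (2 : ℤ) ^ (2 ^ (h + 1) - κ) ∣ intSum 0 (2 ^ (h + 1)) 0 κ := by
  rw [intSum, halfSum_eq_sum_fwdDiff 0 (show 2 ^ (h + 1) < 2 * (2 ^ h + 1) by rw [pow_succ]; omega)]
  refine dvd_sum fun r _ => ?_
  have h2 : (fun l : ℕ => ((l + 0 : ℕ) : ℤ) ^ κ) = fun l : ℕ => (X ^ κ : ℤ[X]).eval (l : ℤ) := by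
    ext l; simp
  rw [h2]
  rcases Nat.eq_zero_or_pos r with rfl | hr
  · simp [h0.ne']
  rcases lt_or_ge κ r with hlt | hge
  · have := fwdDiff_iter_linear_pow_eq_zero 1 0 hlt 0
    simp only [one_mul, add_zero] at this
    simp only [eval_pow, eval_X]
    rw [this, mul_zero]
    exact dvd_zero _
  · obtain ⟨y, hy⟩ := factorial_dvd_fwdDiff_iter (X ^ κ) r 0
    obtain ⟨x, hx⟩ := (halfMoment_dvd (h + 1)).2.1 r hr (by rw [pow_succ]; omega)
    refine (pow_dvd_pow 2 (by omega : 2 ^ (h + 1) - κ ≤ 2 ^ (h + 1) - r)).trans ⟨x * y, ?_⟩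
    rw [hy]
    linear_combination y * hx

/-! ### Relations between the two kinds of power sums -/

theorem two_pow_mul_intSum_zero_sub_oddSum_one (n c κ : ℕ) :
    2 ^ κ * intSum 0 n c κ - oddSum 1 n c κ =
      (-1) ^ n * (fwdDiff 1)^[n] (fun l : ℕ => (l : ℤ) ^ κ) (2 * c) := by
  have h := halfSum_zero_sub_halfSum_one n (fun l => ((l + 2 * c : ℕ) : ℤ) ^ κ)
  have h2 := fwdDiff_iter_comp_add (1 : ℕ) (fun l : ℕ => (l : ℤ) ^ κ) (2 * c) n 0
  rw [zero_add] at h2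
  rw [← h2, ← h, intSum, oddSum, ← halfSum_const_mul]
  congr 2 <;> ext l
  · rw [← mul_pow]; push_cast; ring
  · push_cast; ring

theorem oddSum_zero_sub_two_pow_mul_intSum_one (n c κ : ℕ) :
    oddSum 0 n c κ - 2 ^ κ * intSum 1 n (c + 1) κ =
      (-1) ^ n * (fwdDiff 1)^[n] (fun l : ℕ => (l : ℤ) ^ κ) (2 * c + 1) := by
  have h := halfSum_zero_sub_halfSum_one n (fun l => ((l + (2 * c + 1) : ℕ) : ℤ) ^ κ)
  have h2 := fwdDiff_iter_comp_add (1 : ℕ) (fun l : ℕ => (l : ℤ) ^ κ) (2 * c + 1) n 0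
  rw [zero_add] at h2
  rw [← h2, ← h, intSum, oddSum, ← halfSum_const_mul]
  congr 2 <;> ext l
  · push_cast; ring
  · rw [← mul_pow]; push_cast; ring

theorem fwdDiff_iter_pow_eq_zero {m r : ℕ} (h : m < r) (y : ℕ) :
    (fwdDiff 1)^[r] (fun l : ℕ => (l : ℤ) ^ m) y = 0 := by
  simpa using fwdDiff_iter_linear_pow_eq_zero 1 0 h y

theorem fwdDiff_iter_pow_self (m y : ℕ) :
    (fwdDiff 1)^[m] (fun l : ℕ => (l : ℤ) ^ m) y = m.factorial := by
  simpa using fwdDiff_iter_linear_pow_self 1 0 m y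

theorem oddSum_one_eq_of_lt {n κ : ℕ} (h : κ < n) (c : ℕ) :
    oddSum 1 n c κ = 2 ^ κ * intSum 0 n c κ := by
  have := two_pow_mul_intSum_zero_sub_oddSum_one n c κ
  rw [fwdDiff_iter_pow_eq_zero h, mul_zero] at this
  linarith

theorem oddSum_zero_eq_of_lt {n κ : ℕ} (h : κ < n) (c : ℕ) :
    oddSum 0 n c κ = 2 ^ κ * intSum 1 n (c + 1) κ := by
  have := oddSum_zero_sub_two_pow_mul_intSum_one n c κ
  rw [fwdDiff_iter_pow_eq_zero h, mul_zero] at this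
  linarith

theorem oddSum_one_eq_self {n : ℕ} (hn : Even n) (c : ℕ) :
    oddSum 1 n c n = 2 ^ n * intSum 0 n c n - n.factorial := by
  have := two_pow_mul_intSum_zero_sub_oddSum_one n c n
  rw [fwdDiff_iter_pow_self, hn.neg_one_pow] at this
  linarith

theorem oddSum_zero_eq_self {n : ℕ} (hn : Even n) (c : ℕ) :
    oddSum 0 n c n = 2 ^ n * intSum 1 n (c + 1) n + n.factorial := by
  have := oddSum_zero_sub_two_pow_mul_intSum_one n c n
  rw [fwdDiff_iter_pow_self, hn.neg_one_pow] at this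
  linarith

/-- Halving `n`: the sums `intSum 0 n` at even shifts, reduced to power sums over odd numbers. -/
theorem intSum_zero_even_modEq {h : ℕ} (hh : 1 ≤ h) (c : ℕ) {κ : ℕ} (hκ : 2 ^ h < κ) :
    intSum 0 (2 ^ (h + 1)) (2 * c) κ ≡ -oddSum 1 (2 ^ h) c κ [ZMOD 2 ^ (2 ^ h + 1)] := by
  have h1 := two_pow_mul_intSum_zero_sub_oddSum_one (2 ^ h) c κ
  rw [((Nat.even_pow.2 ⟨even_two, by omega⟩ : Even (2 ^ h))).neg_one_pow, one_mul] at h1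
  refine (intSum_zero_modEq hh (2 * c) κ).trans ?_
  rw [← h1]
  refine Int.modEq_iff_dvd.2 ((pow_dvd_pow 2 (show 2 ^ h + 1 ≤ κ from hκ)).trans
    ⟨-intSum 0 (2 ^ h) c κ, by ring⟩)

/-- Halving `n`: the sums `intSum 0 n` at odd shifts, reduced to power sums over odd numbers. -/
theorem intSum_zero_odd_modEq {h : ℕ} (hh : 1 ≤ h) (c : ℕ) {κ : ℕ} (hκ : 2 ^ h < κ) :
    intSum 0 (2 ^ (h + 1)) (2 * c + 1) κ ≡ oddSum 0 (2 ^ h) c κ [ZMOD 2 ^ (2 ^ h + 1)] := by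
  have h1 := oddSum_zero_sub_two_pow_mul_intSum_one (2 ^ h) c κ
  rw [((Nat.even_pow.2 ⟨even_two, by omega⟩ : Even (2 ^ h))).neg_one_pow, one_mul] at h1
  refine (intSum_zero_modEq hh (2 * c + 1) κ).trans ?_
  rw [← h1]
  refine Int.modEq_iff_dvd.2 ((pow_dvd_pow 2 (show 2 ^ h + 1 ≤ κ from hκ)).trans
    ⟨intSum 1 (2 ^ h) (c + 1) κ, by ring⟩)

/-! ### Dependence on the exponent -/

/-- The binomial coefficient `d choose m` is divisible by the 2-part of `d`, up to the 2-part of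
`m`. -/
theorem two_pow_dvd_two_pow_mul_choose {a d v m : ℕ} (hd : 2 ^ a ∣ d) (hm : Odd m) :
    2 ^ a ∣ 2 ^ v * d.choose (2 ^ v * m) := by
  have hpos : 0 < 2 ^ v * m := Nat.mul_pos (by positivity) hm.pos
  obtain ⟨j, hj⟩ := Nat.exists_eq_succ_of_ne_zero hpos.ne'
  have h1 : 2 ^ a ∣ m * (2 ^ v * d.choose (2 ^ v * m)) := by
    rcases d with _ | d
    · rw [hj]; simp
    · have := Nat.add_one_mul_choose_eq d j
      rw [hj, ← mul_assoc, mul_comm m, hj, mul_comm, ← this]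
      exact hd.mul_right _
  exact (Nat.Coprime.pow_left a ((Nat.coprime_two_left).2 hm)).dvd_of_dvd_mul_left h1

theorem odd_choose_two_pow_mul_sub_one (h : ℕ) {q : ℕ} (hq : 0 < q) :
    Odd ((2 ^ h * q - 1).choose (2 ^ h - 1)) := by
  have : Fact (Nat.Prime 2) := ⟨Nat.prime_two⟩
  induction h with
  | zero => simp
  | succ h ih =>
    have h0 : 0 < 2 ^ h := by positivity
    have h1 : 0 < 2 ^ h * q := by positivity
    have h2 := Choose.choose_modEq_choose_mod_mul_choose_div_nat (p := 2)
      (n := 2 ^ (h + 1) * q - 1) (k := 2 ^ (h + 1) - 1)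
    have h3 : 2 ^ (h + 1) * q = 2 * (2 ^ h * q) := by rw [pow_succ]; ring
    have h4 : 2 ^ (h + 1) = 2 * 2 ^ h := by rw [pow_succ]; ring
    rw [h3, h4, show (2 * (2 ^ h * q) - 1) % 2 = 1 by omega,
      show (2 * 2 ^ h - 1) % 2 = 1 by omega,
      show (2 * (2 ^ h * q) - 1) / 2 = 2 ^ h * q - 1 by omega,
      show (2 * 2 ^ h - 1) / 2 = 2 ^ h - 1 by omega, Nat.choose_self, one_mul] at h2
    rw [h3, h4, Nat.odd_iff]
    rw [Nat.odd_iff] at ih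
    exact Eq.trans h2 ih

/-- The binomial expansion of the power sum in its exponent. -/
theorem oddSum_add (ε n c κ d : ℕ) : oddSum ε n c (κ + d) =
    (2 * c + 1 : ℤ) ^ d * oddSum ε n c κ + ∑ j ∈ range d, (d.choose (j + 1) : ℤ) *
      ((2 * c + 1 : ℤ) ^ (d - (j + 1)) * halfSum ε n (fun l =>
        (X ^ (j + 1) * (X + C (2 * c + 1 : ℤ)) ^ κ : ℤ[X]).eval (2 * l : ℤ))) := by
  rw [oddSum_eq_eval, oddSum_eq_eval, ← halfSum_const_mul]
  simp only [← halfSum_const_mul]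
  rw [← halfSum_finset_sum, ← halfSum_add]
  congr 1
  ext l
  simp only [eval_mul, eval_pow, eval_X, eval_add, eval_C]
  rw [pow_add, add_pow (2 * l : ℤ) (2 * c + 1) d, sum_range_succ', mul_add, mul_sum, add_comm]
  congr 1
  · simp; ring
  · exact sum_congr rfl fun j _ => by ring

theorem halfSum_X_pow_mul (ε n m : ℕ) (p : ℤ[X]) :
    halfSum ε n (fun l => (X ^ m * p).eval (2 * l : ℤ)) =
      2 ^ m * halfSum ε n (fun l => (X ^ m * p.comp (C 2 * X)).eval (l : ℤ)) := by
  rw [← halfSum_const_mul]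
  congr 1
  ext l
  simp
  ring

theorem two_pow_dvd_mul_of_dvd {h b n v : ℕ} {x y : ℤ} (hn : h ≤ n) (hx : 2 ^ (h + b) ∣ 2 ^ v * x)
    (hy : 2 ^ (v + (n - h)) ∣ y) : 2 ^ (n + b) ∣ x * y := by
  obtain ⟨z, rfl⟩ := hy
  have : (2 : ℤ) ^ (n + b) = 2 ^ (h + b) * 2 ^ (n - h) := by
    rw [← pow_add]; congr 1; omega
  rw [this, pow_add 2 v]
  obtain ⟨w, hw⟩ := hx
  exact ⟨w * z, by linear_combination 2 ^ (n - h) * z * hw⟩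

theorem two_pow_add_lt_two_pow_add {h t : ℕ} (hh : 1 ≤ h) (ht : 1 ≤ t) :
    2 ^ h + t + 1 ≤ 2 ^ (h + t) := by
  have hN : 2 ≤ 2 ^ h := by simpa using Nat.pow_le_pow_right (n := 2) (by norm_num) hh
  induction t, ht using Nat.le_induction with
  | base => rw [pow_succ]; omega
  | succ t _ ih => rw [← add_assoc h, pow_succ]; omega

/-- The term of degree `m` in the change of the odd half sum. Writing `m = 2 ^ v * q` with `q` odd,
the binomial coefficient loses `v` factors 2 against `d`; this is made up for by the divisibility of
the half sum, because `v < h` if `m < n / 2`, while the factor `2 ^ m` can be extracted if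
`m ≥ n / 2`. -/
theorem two_pow_dvd_choose_mul_halfSum_one {h b d m : ℕ} (hh : 1 ≤ h) (hd : 2 ^ (h + b) ∣ d)
    (hm : 0 < m) (p : ℤ[X]) : (2 : ℤ) ^ (2 ^ (h + 1) + b) ∣
      d.choose m * halfSum 1 (2 ^ (h + 1)) (fun l => (X ^ m * p).eval (2 * l : ℤ)) := by
  obtain ⟨v, q, hq, rfl⟩ := Nat.exists_eq_two_pow_mul_odd hm.ne'
  have hhN : h < 2 ^ h := Nat.lt_two_pow_self
  have hn : 2 ^ (h + 1) = 2 * 2 ^ h := by rw [pow_succ]; ring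
  have hvm : 2 ^ v ≤ 2 ^ v * q := Nat.le_mul_of_pos_right _ hq.pos
  refine two_pow_dvd_mul_of_dvd (h := h) (v := v) (by omega)
    (by exact_mod_cast two_pow_dvd_two_pow_mul_choose hd hq) ?_
  rcases lt_or_ge (2 ^ v * q) (2 ^ h) with hlt | hge
  · have hv : v < h := (Nat.pow_lt_pow_iff_right (a := 2) (by norm_num)).1 (hvm.trans_lt hlt)
    exact (pow_dvd_pow 2 (by omega)).trans (two_pow_dvd_halfSum_two_mul le_rfl (h + 1) _)
  · rw [halfSum_X_pow_mul]
    have hle : v + (2 ^ (h + 1) - h) ≤ 2 ^ v * q + 2 ^ h := by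
      rcases le_or_gt v h with hv | hv
      · omega
      · have := two_pow_add_lt_two_pow_add hh (show 1 ≤ v - h by omega)
        rw [show h + (v - h) = v by omega] at this
        omega
    refine (pow_dvd_pow 2 hle).trans ?_
    rw [pow_add]
    exact mul_dvd_mul_left _ (two_pow_dvd_halfSum_one h _)

/-- The analogue of `two_pow_dvd_choose_mul_halfSum_one` for the even half sum, where the term of
degree `n / 2` is exceptional. -/
theorem two_pow_dvd_choose_mul_halfSum_zero {h b d m : ℕ} (hh : 1 ≤ h) (hd : 2 ^ (h + b) ∣ d)
    (hm : 0 < m) (hmN : m ≠ 2 ^ h) (p : ℤ[X]) : (2 : ℤ) ^ (2 ^ (h + 1) + b) ∣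
      d.choose m * halfSum 0 (2 ^ (h + 1)) (fun l => (X ^ m * p).eval (2 * l : ℤ)) := by
  obtain ⟨v, q, hq, rfl⟩ := Nat.exists_eq_two_pow_mul_odd hm.ne'
  have hhN : h < 2 ^ h := Nat.lt_two_pow_self
  have hn : 2 ^ (h + 1) = 2 * 2 ^ h := by rw [pow_succ]; ring
  have hvm : 2 ^ v ≤ 2 ^ v * q := Nat.le_mul_of_pos_right _ hq.pos
  refine two_pow_dvd_mul_of_dvd (h := h) (v := v) (by omega)
    (by exact_mod_cast two_pow_dvd_two_pow_mul_choose hd hq) ?_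
  rcases lt_or_ge (2 ^ v * q) (2 ^ h) with hlt | hge
  · have hv : v < h := (Nat.pow_lt_pow_iff_right (a := 2) (by norm_num)).1 (hvm.trans_lt hlt)
    exact (pow_dvd_pow 2 (by omega)).trans (two_pow_dvd_halfSum_two_mul zero_le_one (h + 1) _)
  · rw [halfSum_X_pow_mul]
    have hle : v + (2 ^ (h + 1) - h) ≤ 2 ^ v * q + (2 ^ h - 1) := by
      rcases le_or_gt v h with hv | hv
      · omega
      · have := two_pow_add_lt_two_pow_add hh (show 1 ≤ v - h by omega)
        rw [show h + (v - h) = v by omega] at this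
        omega
    refine (pow_dvd_pow 2 hle).trans ?_
    rw [pow_add]
    exact mul_dvd_mul_left _ (two_pow_dvd_halfSum_zero hh _)

theorem pow_modEq_one_of_two_pow_dvd {u : ℤ} (hu : Odd u) {a d : ℕ} (hd : 2 ^ a ∣ d) :
    u ^ d ≡ 1 [ZMOD 2 ^ (a + 1)] := by
  obtain ⟨q, rfl⟩ := hd
  rw [pow_mul]
  suffices h : u ^ 2 ^ a ≡ 1 [ZMOD 2 ^ (a + 1)] by simpa using h.pow q
  clear q
  induction a with
  | zero => simpa using odd_iff_modEq_one.1 hu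
  | succ a ih =>
    obtain ⟨x, hx⟩ := ih.symm.dvd
    rw [pow_succ 2 a, pow_mul, show u ^ 2 ^ a = 1 + 2 ^ (a + 1) * x by linarith]
    exact (Int.modEq_iff_dvd.2 ⟨-(x + 2 ^ a * x ^ 2), by ring⟩)

/-- Changing the exponent by `d` does not affect the odd half sum modulo `2 ^ (n + b)`. -/
theorem oddSum_one_add_modEq {h b d : ℕ} (hh : 1 ≤ h) (hd : 2 ^ (h + b) ∣ d) (c κ : ℕ) :
    oddSum 1 (2 ^ (h + 1)) c (κ + d) ≡ oddSum 1 (2 ^ (h + 1)) c κ [ZMOD 2 ^ (2 ^ (h + 1) + b)] := by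
  rw [oddSum_add]
  refine Int.ModEq.symm (Int.modEq_iff_dvd.2 ?_)
  rw [add_sub_right_comm]
  refine dvd_add ?_ (dvd_sum fun j _ => ?_)
  · obtain ⟨x, hx⟩ := (pow_modEq_one_of_two_pow_dvd (u := 2 * c + 1) ⟨c, rfl⟩ hd).symm.dvd
    obtain ⟨y, hy⟩ := two_pow_dvd_oddSum le_rfl (h + 1) c κ
    have hle : 2 ^ (h + 1) + b ≤ (h + b + 1) + (2 ^ (h + 1) - 1) := by omega
    refine (pow_dvd_pow 2 hle).trans ⟨x * y, ?_⟩
    rw [← sub_one_mul, hx, hy, pow_add 2 (h + b + 1)]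
    ring
  · rw [mul_left_comm]
    exact (two_pow_dvd_choose_mul_halfSum_one hh hd (Nat.succ_pos j) _).mul_left _

/-- The half sum in the exceptional term of degree `n / 2`, up to a factor `2 ^ (n / 2)`. -/
theorem halfSum_zero_X_pow_mul_modEq {h c κ : ℕ} (hh : 1 ≤ h) :
    halfSum 0 (2 ^ (h + 1)) (fun l => (X ^ 2 ^ h * ((X + C (2 * c + 1 : ℤ)) ^ κ).comp (C 2 * X) :
      ℤ[X]).eval (l : ℤ)) ≡ 2 ^ (2 ^ h - 1) [ZMOD 2 ^ 2 ^ h] := by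
  set u : ℤ := 2 * c + 1 with hu
  have hN : 2 ^ h - 1 + 1 = 2 ^ h := Nat.sub_add_cancel Nat.one_le_two_pow
  obtain ⟨q, hq, hq'⟩ := exists_odd_factorial_two_pow h
  refine ((halfSum_zero_modEq hh _).of_dvd (pow_dvd_pow 2 (Nat.le_succ _))).trans ?_
  -- modulo 2 the polynomial is a multiple of `X ^ (n / 2)`
  obtain ⟨w, hw⟩ : ∃ w : ℤ[X], ((X + C u) ^ κ).comp (C 2 * X) = C (u ^ κ) + C 2 * w := by
    obtain ⟨w, hw⟩ := sub_dvd_pow_sub_pow (C 2 * X + C u : ℤ[X]) (C u) κ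
    refine ⟨X * w, ?_⟩
    simp only [pow_comp, add_comp, X_comp, C_comp, map_pow]
    linear_combination hw
  have h1 : (fun l : ℕ => (X ^ 2 ^ h * ((X + C u) ^ κ).comp (C 2 * X)).eval (l : ℤ)) =
      u ^ κ • (fun l : ℕ => (l : ℤ) ^ 2 ^ h) +
        (2 : ℤ) • (fun l : ℕ => (X ^ 2 ^ h * w).eval (l : ℤ)) := by
    ext l
    rw [hw]
    simp
    ring
  rw [h1, fwdDiff_iter_add, fwdDiff_iter_const_smul, fwdDiff_iter_const_smul, Pi.add_apply,
    Pi.smul_apply, Pi.smul_apply, fwdDiff_iter_pow_self, hq']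
  obtain ⟨y, hy⟩ := factorial_dvd_fwdDiff_iter (X ^ 2 ^ h * w) (2 ^ h) 0
  rw [hy, hq', smul_eq_mul, smul_eq_mul]
  have h2 := two_pow_mul_odd_modEq (((Odd.pow (n := κ) ⟨c, hu⟩ : Odd (u ^ κ)).mul hq).add_even
    (even_two_mul (q * y))) (2 ^ h - 1)
  rw [hN] at h2
  convert h2 using 1
  ring

/-- Changing the exponent by `d` changes the even half sum by exactly `2 ^ (n + b - 1)` modulo
`2 ^ (n + b)`, where `d = 2 ^ (h + b) * q` with `q` odd. The change comes from the term of degree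
`n / 2` in the binomial expansion. -/
theorem oddSum_zero_add_modEq {h b q : ℕ} (hh : 1 ≤ h) (hq : Odd q) (c κ : ℕ) :
    oddSum 0 (2 ^ (h + 1)) c (κ + 2 ^ (h + b) * q) ≡
      oddSum 0 (2 ^ (h + 1)) c κ + 2 ^ (2 ^ (h + 1) + b - 1) [ZMOD 2 ^ (2 ^ (h + 1) + b)] := by
  set d := 2 ^ (h + b) * q with hd'
  have hd : 2 ^ (h + b) ∣ d := dvd_mul_right _ _
  have hN : 0 < 2 ^ h := by positivity
  have hn : 2 ^ (h + 1) = 2 * 2 ^ h := by rw [pow_succ]; ring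
  have hNd : 2 ^ h ≤ d := by
    rw [hd', pow_add, mul_assoc]
    exact Nat.le_mul_of_pos_right _ (Nat.mul_pos (by positivity) hq.pos)
  rw [oddSum_add]
  refine Int.ModEq.add ?_ ?_
  · refine Int.ModEq.symm (Int.modEq_iff_dvd.2 ?_)
    obtain ⟨x, hx⟩ := (pow_modEq_one_of_two_pow_dvd (u := 2 * c + 1) ⟨c, rfl⟩ hd).symm.dvd
    obtain ⟨y, hy⟩ := two_pow_dvd_oddSum zero_le_one (h + 1) c κ
    have hle : 2 ^ (h + 1) + b ≤ (h + b + 1) + (2 ^ (h + 1) - 1) := by omega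
    refine (pow_dvd_pow 2 hle).trans ⟨x * y, ?_⟩
    rw [← sub_one_mul, hx, hy, pow_add 2 (h + b + 1)]
    ring
  · rw [← add_sum_erase _ _ (mem_range.2 (show 2 ^ h - 1 < d by omega))]
    rw [← add_zero (2 ^ (2 ^ (h + 1) + b - 1) : ℤ)]
    refine Int.ModEq.add ?_ (Int.modEq_zero_iff_dvd.2 (dvd_sum fun j hj => ?_))
    · rw [Nat.sub_add_cancel hN, halfSum_X_pow_mul]
      obtain ⟨z, hz⟩ := (halfSum_zero_X_pow_mul_modEq (c := c) (κ := κ) hh).symm.dvd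
      have h1 : (d.choose (2 ^ h) : ℤ) = 2 ^ b * (q * (d - 1).choose (2 ^ h - 1)) := by
        have := Nat.add_one_mul_choose_eq (d - 1) (2 ^ h - 1)
        rw [Nat.sub_add_cancel hN, Nat.sub_add_cancel (hN.trans_le hNd), mul_comm (d.choose _)]
          at this
        have h2 : 2 ^ h * d.choose (2 ^ h) =
            2 ^ h * (2 ^ b * (q * (d - 1).choose (2 ^ h - 1))) := by
          rw [← this, hd', pow_add]; ring
        exact_mod_cast Nat.eq_of_mul_eq_mul_left hN h2
      have h2 : Odd ((d - 1).choose (2 ^ h - 1)) := by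
        have := odd_choose_two_pow_mul_sub_one h (q := 2 ^ b * q)
          (Nat.mul_pos (by positivity) hq.pos)
        rwa [← mul_assoc, ← pow_add] at this
      have h3 : Odd ((q * (d - 1).choose (2 ^ h - 1) : ℤ) * (2 * c + 1 : ℤ) ^ (d - 2 ^ h) *
          (1 + 2 * z)) := by
        refine Odd.mul (Odd.mul ?_ (Odd.pow ⟨c, rfl⟩)) ⟨z, by ring⟩
        exact_mod_cast hq.mul h2
      have h4 := two_pow_mul_odd_modEq h3 (2 ^ (h + 1) + b - 1)
      rw [Nat.sub_add_cancel (by omega)] at h4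
      refine Eq.trans ?_ h4
      congr 1
      have h5 : halfSum 0 (2 ^ (h + 1)) (fun l => (X ^ 2 ^ h *
          ((X + C (2 * c + 1 : ℤ)) ^ κ).comp (C 2 * X) : ℤ[X]).eval (l : ℤ)) =
          2 ^ (2 ^ h - 1) * (1 + 2 * z) := by
        rw [sub_eq_iff_eq_add.1 hz]
        nth_rw 1 [← Nat.sub_add_cancel hN]
        rw [pow_succ]
        ring
      rw [h5, h1, show 2 ^ (h + 1) + b - 1 = b + 2 ^ h + (2 ^ h - 1) by omega, pow_add, pow_add]
      ring
    · rw [mul_left_comm]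
      refine (two_pow_dvd_choose_mul_halfSum_zero hh hd (Nat.succ_pos j) ?_ _).mul_left _
      have := (mem_erase.1 hj).1
      omega

/-- The change of the odd half sum under a change of the exponent hardly depends on the shift. -/
theorem oddSum_one_add_sub_modEq {h b d : ℕ} (hh : 1 ≤ h) (hd : 2 ^ (h + b) ∣ d) (c c' κ : ℕ) :
    oddSum 1 (2 ^ (h + 1)) c (κ + d) - oddSum 1 (2 ^ (h + 1)) c κ ≡
      oddSum 1 (2 ^ (h + 1)) c' (κ + d) - oddSum 1 (2 ^ (h + 1)) c' κ
        [ZMOD 2 ^ (2 ^ (h + 1) + b + 1)] := by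
  have key : ∀ c : ℕ, (2 : ℤ) ^ (2 ^ (h + 1) + b + 1) ∣
      ((2 * c + 1 : ℤ) ^ d - 1) * oddSum 1 (2 ^ (h + 1)) c κ := by
    intro c
    obtain ⟨x, hx⟩ := (pow_modEq_one_of_two_pow_dvd (u := 2 * c + 1) ⟨c, rfl⟩ hd).symm.dvd
    obtain ⟨y, hy⟩ := two_pow_dvd_oddSum le_rfl (h + 1) c κ
    have hle : 2 ^ (h + 1) + b + 1 ≤ (h + b + 1) + (2 ^ (h + 1) - 1) := by omega
    refine (pow_dvd_pow 2 hle).trans ⟨x * y, ?_⟩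
    rw [hx, hy, pow_add 2 (h + b + 1)]
    ring
  refine Int.modEq_iff_dvd.2 ?_
  rw [oddSum_add, oddSum_add]
  have h1 : ∀ A B C D E F : ℤ, A * B + C - B - (D * E + F - E) =
      (A - 1) * B - (D - 1) * E + (C - F) := by intros; ring
  rw [h1, ← sum_sub_distrib]
  refine dvd_add (dvd_sub (key c') (key c)) (dvd_sum fun j _ => ?_)
  set m := j + 1
  -- the two polynomials agree modulo 2
  obtain ⟨w, hw⟩ : ∃ w : ℤ[X], C ((2 * c' + 1 : ℤ) ^ (d - m)) * (X + C (2 * c' + 1 : ℤ)) ^ κ -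
      C ((2 * c + 1 : ℤ) ^ (d - m)) * (X + C (2 * c + 1 : ℤ)) ^ κ = C 2 * w := by
    obtain ⟨w₁, h₁⟩ := sub_dvd_pow_sub_pow (C (2 * c' + 1 : ℤ)) (C (2 * c + 1 : ℤ)) (d - m)
    obtain ⟨w₂, h₂⟩ := sub_dvd_pow_sub_pow (X + C (2 * c' + 1 : ℤ)) (X + C (2 * c + 1 : ℤ)) κ
    have h3 : (C (2 * c' + 1 : ℤ) : ℤ[X]) - C (2 * c + 1 : ℤ) = C 2 * C (c' - c : ℤ) := by
      rw [← C_sub, ← C_mul]; congr 1; ring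
    refine ⟨C (c' - c : ℤ) * w₁ * (X + C (2 * c' + 1 : ℤ)) ^ κ +
      C ((2 * c + 1 : ℤ) ^ (d - m)) * (C (c' - c : ℤ) * w₂), ?_⟩
    rw [add_sub_add_left_eq_sub] at h₂
    rw [h3] at h₁ h₂
    simp only [map_pow]
    linear_combination (X + C (2 * c' + 1 : ℤ)) ^ κ * h₁ + (C (2 * c + 1 : ℤ)) ^ (d - m) * h₂
  have h2 : (2 * c' + 1 : ℤ) ^ (d - m) * halfSum 1 (2 ^ (h + 1)) (fun l =>
        (X ^ m * (X + C (2 * c' + 1 : ℤ)) ^ κ : ℤ[X]).eval (2 * l : ℤ)) -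
      (2 * c + 1 : ℤ) ^ (d - m) * halfSum 1 (2 ^ (h + 1)) (fun l =>
        (X ^ m * (X + C (2 * c + 1 : ℤ)) ^ κ : ℤ[X]).eval (2 * l : ℤ)) =
      2 * halfSum 1 (2 ^ (h + 1)) (fun l => (X ^ m * w).eval (2 * l : ℤ)) := by
    rw [← halfSum_const_mul, ← halfSum_const_mul, ← halfSum_const_mul, ← halfSum_sub]
    congr 1
    ext l
    have h4 := congrArg (eval (2 * l : ℤ)) hw
    simp only [eval_sub, eval_mul, eval_C, eval_pow, eval_X, eval_add] at h4 ⊢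
    linear_combination (2 * l : ℤ) ^ m * h4
  rw [← mul_sub, h2, mul_left_comm, pow_succ']
  exact mul_dvd_mul_left 2 (two_pow_dvd_choose_mul_halfSum_one hh hd (Nat.succ_pos j) w)

/-! ### The sums `intSum 0 n` modulo powers of 2 -/

theorem not_two_pow_succ_dvd_two_pow (s : ℕ) : ¬ (2 : ℤ) ^ (s + 1) ∣ 2 ^ s := by
  intro h
  have := Int.le_of_dvd (by positivity) h
  rw [pow_succ] at this
  have : (0 : ℤ) < 2 ^ s := by positivity
  linarith

theorem two_pow_dvd_two_pow_mul_iff (s t : ℕ) (x : ℤ) :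
    (2 : ℤ) ^ (s + t) ∣ 2 ^ s * x ↔ 2 ^ t ∣ x := by
  rw [pow_add]
  exact mul_dvd_mul_iff_left (by positivity)

theorem oddSum_exponent_zero {ε : ℕ} (hε : ε ≤ 1) (n c : ℕ) : oddSum ε (n + 1) c 0 = 2 ^ n := by
  have h : oddSum ε (n + 1) c 0 = halfMoment ε (n + 1) 0 := by simp [oddSum, halfMoment]
  rw [h]
  interval_cases ε
  · exact (halfMoment_zero_zero n).1
  · exact (halfMoment_zero_zero n).2

/-- The case `d = N = 2 ^ (g + 1)` of `oddSum_zero_add_modEq`, for half sums at `N`. -/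
theorem oddSum_zero_self_add_modEq {g : ℕ} (hg : 1 ≤ g) (c κ : ℕ) :
    oddSum 0 (2 ^ (g + 1)) c (2 ^ (g + 1) + κ) ≡
      oddSum 0 (2 ^ (g + 1)) c κ + 2 ^ 2 ^ (g + 1) [ZMOD 2 ^ (2 ^ (g + 1) + 1)] := by
  have := oddSum_zero_add_modEq (b := 1) hg odd_one c κ
  rwa [mul_one, Nat.add_sub_cancel, add_comm κ] at this

theorem oddSum_one_self_add_modEq {g : ℕ} (hg : 1 ≤ g) (c κ : ℕ) :
    oddSum 1 (2 ^ (g + 1)) c (2 ^ (g + 1) + κ) ≡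
      oddSum 1 (2 ^ (g + 1)) c κ [ZMOD 2 ^ (2 ^ (g + 1) + 1)] := by
  have := oddSum_one_add_modEq (b := 1) hg dvd_rfl c κ
  rwa [add_comm κ] at this

/-- For exponents `N + κ` with `0 < κ ≤ N / 2`, where `N = n / 2`, the sums at the shifts `0` and
`1` differ modulo `2 ^ N`: exactly one of them is divisible by `2 ^ N`. -/
theorem intSum_zero_one_not_modEq_of_le {g κ : ℕ} (hg : 1 ≤ g) (h0 : 0 < κ) (hκ : κ ≤ 2 ^ g) :
    ¬ intSum 0 (2 ^ (g + 2)) 1 (2 ^ (g + 1) + κ) ≡ intSum 0 (2 ^ (g + 2)) 0 (2 ^ (g + 1) + κ)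
      [ZMOD 2 ^ 2 ^ (g + 1)] := by
  intro hmod
  have hH : 2 ≤ 2 ^ g := by simpa using Nat.pow_le_pow_right (n := 2) (by norm_num) hg
  have hN : 2 ^ (g + 1) = 2 * 2 ^ g := by rw [pow_succ]; ring
  have hN1 : 2 ^ (g + 1) - 1 + 1 = 2 ^ (g + 1) := by omega
  have hred : ∀ {x y : ℤ}, x ≡ y [ZMOD 2 ^ (2 ^ (g + 1) + 1)] → x ≡ y [ZMOD 2 ^ 2 ^ (g + 1)] :=
    fun h => h.of_dvd (pow_dvd_pow 2 (Nat.le_succ _))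
  have e1 := hred ((intSum_zero_odd_modEq (h := g + 1) (by omega) 0
    (show 2 ^ (g + 1) < 2 ^ (g + 1) + κ by omega)).trans (oddSum_zero_self_add_modEq hg 0 κ))
  have e0 := hred ((intSum_zero_even_modEq (h := g + 1) (by omega) 0
    (show 2 ^ (g + 1) < 2 ^ (g + 1) + κ by omega)).trans (oddSum_one_self_add_modEq hg 0 κ).neg)
  have e2 : oddSum 0 (2 ^ (g + 1)) 0 κ + 2 ^ 2 ^ (g + 1) ≡ -oddSum 1 (2 ^ (g + 1)) 0 κ
      [ZMOD 2 ^ 2 ^ (g + 1)] := (e1.symm.trans hmod).trans e0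
  have e3 : (2 : ℤ) ^ 2 ^ (g + 1) ∣ oddSum 0 (2 ^ (g + 1)) 0 κ + oddSum 1 (2 ^ (g + 1)) 0 κ := by
    obtain ⟨z, hz⟩ := e2.dvd
    exact ⟨-z - 1, by linear_combination -hz⟩
  rcases hκ.lt_or_eq with hlt | rfl
  · have h1 : (2 : ℤ) ^ 2 ^ (g + 1) ∣ oddSum 1 (2 ^ (g + 1)) 0 κ := by
      rw [oddSum_one_eq_of_lt (by omega), show 2 ^ (g + 1) = κ + (2 ^ (g + 1) - κ) by omega,
        two_pow_dvd_two_pow_mul_iff, show κ + (2 ^ (g + 1) - κ) = 2 ^ (g + 1) by omega]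
      exact two_pow_dvd_intSum_zero_of_lt h0 hlt
    have h2 := (oddSum_zero_modEq_of_lt (c := 0) hlt).dvd
    have h3 := dvd_add h2 ((dvd_add_left h1).1 e3)
    rw [sub_add_cancel] at h3
    have := not_two_pow_succ_dvd_two_pow (2 ^ (g + 1) - 1)
    rw [hN1] at this
    exact this h3
  · have h1 : (2 : ℤ) ^ 2 ^ (g + 1) ∣ oddSum 0 (2 ^ (g + 1)) 0 (2 ^ g) := by
      rw [oddSum_zero_eq_of_lt (by omega)]
      have := two_pow_dvd_intSum_one g (0 + 1) (2 ^ g)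
      rw [← two_pow_dvd_two_pow_mul_iff (2 ^ g)] at this
      rwa [hN, two_mul, ← two_mul, ← hN] at this ⊢
    have h2 := (dvd_add_right h1).1 e3
    rw [oddSum_one_eq_of_lt (by omega)] at h2
    have h3 : (2 : ℤ) ^ 2 ^ g ∣ intSum 0 (2 ^ (g + 1)) 0 (2 ^ g) := by
      rw [← two_pow_dvd_two_pow_mul_iff (2 ^ g), ← two_mul, ← hN]
      exact h2
    have h4 := (intSum_zero_modEq hg 0 (2 ^ g)).of_dvd (pow_dvd_pow 2 (Nat.le_succ _))
    obtain ⟨q, hq, hq'⟩ := exists_odd_factorial_two_pow g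
    rw [fwdDiff_iter_pow_self, hq'] at h4
    have h5 := two_pow_mul_odd_modEq hq (2 ^ g - 1)
    rw [Nat.sub_add_cancel (by omega)] at h5
    have h6 := (dvd_sub_comm.1 (h4.trans h5).dvd)
    have h7 := (dvd_sub_right h3).1 h6
    have := not_two_pow_succ_dvd_two_pow (2 ^ g - 1)
    rw [Nat.sub_add_cancel (by omega)] at this
    exact this h7

/-- For exponents `N + κ` with `N / 2 < κ < N`, where `N = n / 2`, the sums at odd shifts have
valuation exactly `N`. -/
theorem intSum_zero_odd_modEq_of_gt {g κ : ℕ} (hg : 1 ≤ g) (hκ : 2 ^ g < κ) (hκ' : κ < 2 ^ (g + 1))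
    (c : ℕ) :
    intSum 0 (2 ^ (g + 2)) (2 * c + 1) (2 ^ (g + 1) + κ) ≡ 2 ^ 2 ^ (g + 1)
      [ZMOD 2 ^ (2 ^ (g + 1) + 1)] := by
  have hN : 2 ^ (g + 1) = 2 * 2 ^ g := by rw [pow_succ]; ring
  have e1 := (intSum_zero_odd_modEq (h := g + 1) (by omega) c
    (show 2 ^ (g + 1) < 2 ^ (g + 1) + κ by omega)).trans (oddSum_zero_self_add_modEq hg c κ)
  refine e1.trans ?_
  have h1 : oddSum 0 (2 ^ (g + 1)) c κ ≡ 0 [ZMOD 2 ^ (2 ^ (g + 1) + 1)] := by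
    rw [Int.modEq_zero_iff_dvd, oddSum_zero_eq_of_lt hκ']
    refine (pow_dvd_pow 2 (show 2 ^ (g + 1) + 1 ≤ κ + 2 ^ g by omega)).trans ?_
    rw [two_pow_dvd_two_pow_mul_iff]
    exact two_pow_dvd_intSum_one g _ _
  simpa using h1.add_right (2 ^ 2 ^ (g + 1))

theorem intSum_zero_even_modEq_of_gt {g κ : ℕ} (hg : 1 ≤ g) (hκ : 2 ^ g < κ) (hκ' : κ < 2 ^ (g + 1))
    (c : ℕ) : intSum 0 (2 ^ (g + 2)) (2 * c) (2 ^ (g + 1) + κ) ≡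
      -(2 ^ κ * intSum 0 (2 ^ (g + 1)) c κ) [ZMOD 2 ^ (2 ^ (g + 1) + 1)] := by
  have e0 := (intSum_zero_even_modEq (h := g + 1) (by omega) c
    (show 2 ^ (g + 1) < 2 ^ (g + 1) + κ by omega)).trans (oddSum_one_self_add_modEq hg c κ).neg
  rwa [oddSum_one_eq_of_lt hκ'] at e0

theorem two_pow_dvd_intSum_zero_of_gt {g κ : ℕ} (hg : 1 ≤ g) (hκ : 2 ^ g < κ)
    (hκ' : κ < 2 ^ (g + 1)) (c : ℕ) :
    (2 : ℤ) ^ 2 ^ (g + 1) ∣ intSum 0 (2 ^ (g + 2)) c (2 ^ (g + 1) + κ) := by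
  have hN : 2 ^ (g + 1) = 2 * 2 ^ g := by rw [pow_succ]; ring
  have hle : (2 : ℤ) ^ 2 ^ (g + 1) ∣ 2 ^ (2 ^ (g + 1) + 1) := pow_dvd_pow 2 (Nat.le_succ _)
  obtain ⟨c, rfl | rfl⟩ := Nat.even_or_odd' c
  · rw [← Int.modEq_zero_iff_dvd]
    refine ((intSum_zero_even_modEq_of_gt hg hκ hκ' c).of_dvd hle).trans ?_
    rw [Int.modEq_zero_iff_dvd, dvd_neg]
    refine (pow_dvd_pow 2 (show 2 ^ (g + 1) ≤ κ + (2 ^ g - 1) by omega)).trans ?_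
    rw [two_pow_dvd_two_pow_mul_iff]
    exact two_pow_dvd_intSum_zero hg _ _
  · rw [← Int.modEq_zero_iff_dvd]
    refine ((intSum_zero_odd_modEq_of_gt hg hκ hκ' c).of_dvd hle).trans ?_
    simp

/-- In the situation of `intSum_zero_odd_modEq_of_gt`, one of the shifts `0`, `2` gives a sum of
valuation larger than `N`. -/
theorem exists_two_pow_dvd_intSum_zero {g κ : ℕ} (hg : 1 ≤ g) (hκ : 2 ^ g < κ)
    (hκ' : κ < 2 ^ (g + 1)) : ∃ c ≤ 1,
      (2 : ℤ) ^ (2 ^ (g + 1) + 1) ∣ intSum 0 (2 ^ (g + 2)) (2 * c) (2 ^ (g + 1) + κ) := by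
  have hH : 2 ≤ 2 ^ g := by simpa using Nat.pow_le_pow_right (n := 2) (by norm_num) hg
  have hN : 2 ^ (g + 1) = 2 * 2 ^ g := by rw [pow_succ]; ring
  suffices h : ∃ c ≤ 1, (2 : ℤ) ^ (2 ^ (g + 1) + 1) ∣ 2 ^ κ * intSum 0 (2 ^ (g + 1)) c κ by
    obtain ⟨c, hc, h⟩ := h
    refine ⟨c, hc, ?_⟩
    rw [← Int.modEq_zero_iff_dvd]
    refine (intSum_zero_even_modEq_of_gt hg hκ hκ' c).trans ?_
    rwa [Int.modEq_zero_iff_dvd, dvd_neg]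
  rcases (show 2 ^ g + 2 ≤ κ ∨ κ = 2 ^ g + 1 by omega) with hlt | rfl
  · refine ⟨0, zero_le_one, ?_⟩
    refine (pow_dvd_pow 2 (show 2 ^ (g + 1) + 1 ≤ κ + (2 ^ g - 1) by omega)).trans ?_
    rw [two_pow_dvd_two_pow_mul_iff]
    exact two_pow_dvd_intSum_zero hg _ _
  · have e : 2 ^ (g + 1) + 1 = 2 ^ g + 1 + 2 ^ g := by omega
    simp only [e, two_pow_dvd_two_pow_mul_iff]
    have hle : (2 : ℤ) ^ 2 ^ g ∣ 2 ^ (2 ^ g + 1) := pow_dvd_pow 2 (Nat.le_succ _)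
    obtain ⟨x, hx⟩ := two_pow_dvd_intSum_zero hg 0 (2 ^ g + 1)
    obtain ⟨y, hy⟩ := two_pow_dvd_intSum_zero hg 1 (2 ^ g + 1)
    have hd := (((intSum_zero_modEq hg 1 (2 ^ g + 1)).sub
      (intSum_zero_modEq hg 0 (2 ^ g + 1))).of_dvd hle)
    -- the two values differ by a factorial, whose valuation is `2 ^ g - 1`
    have hf : (fwdDiff 1)^[2 ^ g] (fun l : ℕ => (l : ℤ) ^ (2 ^ g + 1)) 1 -
        (fwdDiff 1)^[2 ^ g] (fun l : ℕ => (l : ℤ) ^ (2 ^ g + 1)) 0 = (2 ^ g + 1).factorial := by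
      rw [← fwdDiff_iter_pow_self _ 0, Function.iterate_succ_apply']
      rfl
    obtain ⟨q, hq, hq'⟩ := exists_odd_factorial_two_pow g
    rw [hf, Nat.factorial_succ, Nat.cast_mul, hq', mul_left_comm] at hd
    have h5 : Odd (((2 ^ g + 1 : ℕ) : ℤ) * q) := by
      refine Odd.mul ?_ hq
      exact_mod_cast (Nat.even_pow.2 ⟨even_two, by omega⟩ : Even (2 ^ g)).add_one
    have h6 := two_pow_mul_odd_modEq h5 (2 ^ g - 1)
    rw [Nat.sub_add_cancel (by omega)] at h6
    have h7 := (hd.trans h6).dvd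
    have h8 : (2 : ℤ) ^ 2 ^ g = 2 ^ (2 ^ g - 1) * 2 := by
      rw [← pow_succ, Nat.sub_add_cancel (by omega)]
    rw [hx, hy, h8] at h7
    have h9 : (2 : ℤ) ∣ 1 - (y - x) := by
      refine (mul_dvd_mul_iff_left (show (2 : ℤ) ^ (2 ^ g - 1) ≠ 0 by positivity)).1 ?_
      obtain ⟨z, hz⟩ := h7
      exact ⟨z, by linear_combination hz⟩
    rcases Int.even_or_odd x with he | ho
    · refine ⟨0, zero_le_one, ?_⟩
      rw [hx, h8]
      exact mul_dvd_mul_left _ he.two_dvd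
    · refine ⟨1, le_rfl, ?_⟩
      rw [hy, h8]
      refine mul_dvd_mul_left _ ?_
      obtain ⟨z, rfl⟩ := ho
      omega

/-- For `n / 2 < κ < n` the sums `intSum 0 n c κ` share a factor `2 ^ s` with `s ≤ n / 2`, and are
not constant in `c` modulo `2 ^ (s + 1)`. -/
theorem exists_intSum_zero_not_modEq {h κ : ℕ} (hh : 1 ≤ h) (hκ : 2 ^ h < κ)
    (hκ' : κ < 2 ^ (h + 1)) : ∃ s ≤ 2 ^ h, (∀ c, (2 : ℤ) ^ s ∣ intSum 0 (2 ^ (h + 1)) c κ) ∧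
      ∃ c, ¬ intSum 0 (2 ^ (h + 1)) (c + 1) κ ≡ intSum 0 (2 ^ (h + 1)) c κ [ZMOD 2 ^ (s + 1)] := by
  rcases hh.eq_or_lt with rfl | hlt
  · obtain rfl : κ = 3 := by omega
    refine ⟨1, by norm_num, fun c => ?_, 0, ?_⟩
    · simpa using two_pow_dvd_intSum_zero le_rfl c 3
    · simp [intSum, halfSum, sum_range_succ, Nat.choose, Int.ModEq]
  obtain ⟨g, rfl⟩ := Nat.exists_eq_add_of_le' (show 1 ≤ h by omega)
  have hg : 1 ≤ g := by omega
  obtain ⟨κ, rfl⟩ := Nat.exists_eq_add_of_le hκ.le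
  have hN : 2 ^ (g + 1) = 2 * 2 ^ g := by rw [pow_succ]; ring
  have hn : 2 ^ (g + 1 + 1) = 2 * 2 ^ (g + 1) := by rw [pow_succ]; ring
  have hH : 0 < 2 ^ g := by positivity
  rcases le_or_gt κ (2 ^ g) with hle | hgt
  · refine ⟨2 ^ (g + 1) - 1, by omega, fun c => two_pow_dvd_intSum_zero (by omega) c _, 0, ?_⟩
    rw [Nat.sub_add_cancel (by omega)]
    exact intSum_zero_one_not_modEq_of_le hg (by omega) hle
  · have hκ2 : κ < 2 ^ (g + 1) := by omega
    refine ⟨2 ^ (g + 1), le_rfl, two_pow_dvd_intSum_zero_of_gt hg hgt hκ2, ?_⟩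
    obtain ⟨c, hc, hdvd⟩ := exists_two_pow_dvd_intSum_zero hg hgt hκ2
    have h1 := intSum_zero_odd_modEq_of_gt hg hgt hκ2 0
    rw [← Int.modEq_zero_iff_dvd] at hdvd
    have h2 : ¬ (2 : ℤ) ^ 2 ^ (g + 1) ≡ 0 [ZMOD 2 ^ (2 ^ (g + 1) + 1)] := by
      rw [Int.modEq_zero_iff_dvd]
      exact not_two_pow_succ_dvd_two_pow _
    interval_cases c
    · exact ⟨0, fun h => h2 ((h1.symm.trans h).trans hdvd)⟩
    · exact ⟨1, fun h => h2 ((h1.symm.trans h.symm).trans hdvd)⟩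

/-- At `κ = n` the power sums over odd numbers, with `n / 2` in place of `n`, are explicit. -/
theorem oddSum_double_modEq {h ε : ℕ} (hh : 1 ≤ h) (hε : ε ≤ 1) (c : ℕ) :
    oddSum ε (2 ^ h) c (2 ^ (h + 1)) ≡ 2 ^ (2 ^ h - 1) [ZMOD 2 ^ (2 ^ h + 1)] := by
  rcases hh.eq_or_lt with rfl | hlt
  · -- `n / 2 = 2` is too small for the formulas for a change of the exponent
    have h4 : ∀ x : ℤ, (2 * x + 1) ^ 4 ≡ 1 [ZMOD 8] := fun x =>
      Int.modEq_iff_dvd.2 ⟨-(2 * x ^ 4 + 4 * x ^ 3 + 3 * x ^ 2 + x), by ring⟩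
    interval_cases ε
    · have := (h4 c).add (h4 (1 + c))
      simpa [oddSum, halfSum, sum_range_succ, Nat.choose] using this
    · have := (h4 c).mul_left 2
      simpa [oddSum, halfSum, sum_range_succ, Nat.choose] using this
  obtain ⟨g, rfl⟩ := Nat.exists_eq_add_of_le' (show 1 ≤ h by omega)
  have hg : 1 ≤ g := by omega
  have h0 : 2 ^ (g + 1) - 1 + 1 = 2 ^ (g + 1) := Nat.sub_add_cancel Nat.one_le_two_pow
  have h1 := oddSum_exponent_zero hε (2 ^ (g + 1) - 1) c
  rw [h0] at h1
  rw [← h1]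
  have hle : (2 : ℤ) ^ (2 ^ (g + 1) + 1) ∣ 2 ^ (2 ^ (g + 1) + 2) := pow_dvd_pow 2 (by omega)
  interval_cases ε
  · have := (oddSum_zero_add_modEq (b := 2) hg odd_one c 0).of_dvd hle
    rw [zero_add, mul_one, show g + 2 = g + 1 + 1 from rfl,
      show 2 ^ (g + 1) + 2 - 1 = 2 ^ (g + 1) + 1 by omega] at this
    refine this.trans ?_
    simp
  · have := (oddSum_one_add_modEq (b := 2) hg dvd_rfl c 0).of_dvd hle
    rwa [zero_add] at this

theorem intSum_zero_self_modEq {h : ℕ} (hh : 1 ≤ h) (c : ℕ) :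
    intSum 0 (2 ^ (h + 1)) c (2 ^ (h + 1)) ≡ 2 ^ (2 ^ h - 1) [ZMOD 2 ^ 2 ^ h] := by
  have hN : 0 < 2 ^ h := by positivity
  have hlt : 2 ^ h < 2 ^ (h + 1) := by rw [pow_succ]; omega
  have hle : (2 : ℤ) ^ 2 ^ h ∣ 2 ^ (2 ^ h + 1) := pow_dvd_pow 2 (Nat.le_succ _)
  obtain ⟨c, rfl | rfl⟩ := Nat.even_or_odd' c
  · refine (((intSum_zero_even_modEq hh c hlt).trans
      (oddSum_double_modEq hh le_rfl c).neg).of_dvd hle).trans ?_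
    refine Int.modEq_iff_dvd.2 ⟨1, ?_⟩
    nth_rw 3 [← Nat.sub_add_cancel hN]
    rw [pow_succ]
    ring
  · exact ((intSum_zero_odd_modEq hh c hlt).trans
      (oddSum_double_modEq hh zero_le_one c)).of_dvd hle

/-- At `κ = n` the sums at the shifts `0` and `1` are `-2 ^ (n / 2 - 1)` and `2 ^ (n / 2 - 1)`
modulo `2 ^ (n / 2 + 1)`. -/
theorem intSum_zero_one_sub_zero_self_modEq {h : ℕ} (hh : 1 ≤ h) :
    intSum 0 (2 ^ (h + 1)) 1 (2 ^ (h + 1)) - intSum 0 (2 ^ (h + 1)) 0 (2 ^ (h + 1)) ≡ 2 ^ 2 ^ h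
      [ZMOD 2 ^ (2 ^ h + 1)] := by
  have hN : 0 < 2 ^ h := by positivity
  have hlt : 2 ^ h < 2 ^ (h + 1) := by rw [pow_succ]; omega
  have h0 := (intSum_zero_even_modEq hh 0 hlt).trans (oddSum_double_modEq hh le_rfl 0).neg
  have h1 := (intSum_zero_odd_modEq hh 0 hlt).trans (oddSum_double_modEq hh zero_le_one 0)
  have h2 := h1.sub h0
  rwa [sub_neg_eq_add, ← two_mul, ← pow_succ', Nat.sub_add_cancel hN] at h2

/-! ### The minimum over all `j ≥ n` -/

theorem oddSum_one_succ (n c κ : ℕ) :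
    oddSum 1 (n + 1) c κ = oddSum 1 n c κ + oddSum 0 n c κ :=
  halfSum_one_succ n _

theorem oddSum_zero_succ (n c κ : ℕ) :
    oddSum 0 (n + 1) c κ = oddSum 0 n c κ + oddSum 1 n (c + 1) κ := by
  unfold oddSum
  rw [halfSum_zero_succ]
  congr 2
  ext l
  rw [add_right_comm l 1 c, add_assoc l c 1]

/-- A common divisor of the partial Stirling numbers with `j ≥ n` is the same as a common divisor
of all shifted power sums at `n`: the polynomials `(1 + x) ^ j`, `j ≥ n`, and
`(1 + x) ^ n * x ^ c`, `c ≥ 0`, span the same group. -/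
theorem forall_dvd_oddSum_iff (t : ℤ) (n κ : ℕ) :
    (∀ j, n ≤ j → t ∣ oddSum 1 j 0 κ) ↔ ∀ c, t ∣ oddSum 0 n c κ ∧ t ∣ oddSum 1 n c κ := by
  constructor
  · intro h
    have h1 : ∀ c j, n ≤ j → t ∣ oddSum 1 j c κ := by
      intro c
      induction c with
      | zero => exact h
      | succ c ih =>
        have h0 : ∀ j, n ≤ j → t ∣ oddSum 0 j c κ := fun j hj => by
          have := ih (j + 1) (by omega)
          rw [oddSum_one_succ] at this
          exact (dvd_add_right (ih j hj)).1 this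
        intro j hj
        have := h0 (j + 1) (by omega)
        rw [oddSum_zero_succ] at this
        exact (dvd_add_right (h0 j hj)).1 this
    intro c
    refine ⟨?_, h1 c n le_rfl⟩
    have := h1 c (n + 1) (by omega)
    rw [oddSum_one_succ] at this
    exact (dvd_add_right (h1 c n le_rfl)).1 this
  · intro h j hj
    suffices h1 : ∀ c, t ∣ oddSum 0 j c κ ∧ t ∣ oddSum 1 j c κ from (h1 0).2
    induction j, hj using Nat.le_induction with
    | base => exact h
    | succ j _ ih =>
      intro c
      rw [oddSum_zero_succ, oddSum_one_succ]
      exact ⟨dvd_add (ih c).1 (ih (c + 1)).2, dvd_add (ih c).2 (ih c).1⟩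

theorem partialStirling_natCast (j κ : ℕ) : partialStirling j κ = (oddSum 1 j 0 κ : ℚ) := by
  unfold partialStirling oddSum
  rw [halfSum_eq_sum_range 1 le_rfl, Int.cast_sum]
  have h1 : ∑ i ∈ (range (j + 1)).filter (fun i => Odd i), (j.choose i : ℚ) * (i : ℚ) ^ (κ : ℤ) =
      ∑ i ∈ (range (2 * (j + 1))).filter (fun i => Odd i),
        (j.choose i : ℚ) * (i : ℚ) ^ (κ : ℤ) := by
    refine sum_subset (filter_subset_filter _ (by simp)) fun i hi hi' => ?_
    simp only [mem_filter, mem_range] at hi hi'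
    rw [Nat.choose_eq_zero_of_lt (by by_contra hlt; exact hi' ⟨by omega, hi.2⟩)]
    simp
  rw [h1]
  refine sum_nbij' (fun i => i / 2) (fun l => 2 * l + 1) ?_ ?_ ?_ ?_ ?_
  · intro i hi
    simp only [mem_filter, mem_range] at hi ⊢
    omega
  · intro l hl
    simp only [mem_filter, mem_range] at hl ⊢
    exact ⟨by omega, l, rfl⟩
  · intro i hi
    exact Nat.two_mul_div_two_add_one_of_odd (mem_filter.1 hi).2
  · intro l _
    omega
  · intro i hi
    obtain ⟨l, rfl⟩ := (mem_filter.1 hi).2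
    rw [show (2 * l + 1) / 2 = l by omega]
    push_cast
    simp

theorem padicNorm_odd_zpow {i : ℕ} (hi : Odd i) (k : ℤ) : padicNorm 2 ((i : ℚ) ^ k) = 1 := by
  have h1 : padicNorm 2 (i : ℚ) = 1 := by
    rw [padicNorm.nat_eq_one_iff]
    exact hi.not_two_dvd_nat
  have h : ∀ m : ℕ, padicNorm 2 ((i : ℚ) ^ m) = 1 := by
    intro m
    induction m with
    | zero => simp
    | succ m ih => rw [pow_succ, padicNorm.mul, ih, h1, one_mul]
  obtain ⟨m, rfl | rfl⟩ := k.eq_nat_or_neg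
  · rw [zpow_natCast, h]
  · rw [zpow_neg, zpow_natCast, ← one_div, padicNorm.div, h]
    simp

/-- The partial Stirling numbers are 2-adically continuous in the exponent. -/
theorem padicNorm_partialStirling_sub_le {B κ w : ℕ} {k : ℤ} (hk : (κ : ℤ) = k + 2 ^ B * w)
    (j : ℕ) : padicNorm 2 (partialStirling j κ - partialStirling j k) ≤ 2 ^ (-(B : ℤ)) := by
  unfold partialStirling
  rw [← sum_sub_distrib]
  refine padicNorm.sum_le' (fun i hi => ?_) (by positivity)
  have hi' : Odd i := (mem_filter.1 hi).2
  have hi0 : (i : ℚ) ≠ 0 := by exact_mod_cast hi'.pos.ne'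
  have h1 : (j.choose i : ℚ) * (i : ℚ) ^ (κ : ℤ) - j.choose i * (i : ℚ) ^ k =
      j.choose i * ((i : ℚ) ^ k * (((i : ℤ) ^ (2 ^ B * w) - 1 : ℤ) : ℚ)) := by
    rw [hk, zpow_add₀ hi0]
    have : (i : ℚ) ^ ((2 : ℤ) ^ B * w) = (i : ℚ) ^ (2 ^ B * w) := by
      rw [← zpow_natCast]; push_cast; rfl
    rw [this]
    push_cast
    ring
  have h2 : (2 : ℤ) ^ B ∣ (i : ℤ) ^ (2 ^ B * w) - 1 :=
    (pow_dvd_pow 2 (Nat.le_succ B)).trans (pow_modEq_one_of_two_pow_dvd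
      (by exact_mod_cast hi') (dvd_mul_right _ _)).symm.dvd
  have h3 : padicNorm 2 (((i : ℤ) ^ (2 ^ B * w) - 1 : ℤ) : ℚ) ≤ 2 ^ (-(B : ℤ)) := by
    have := (padicNorm.dvd_iff_norm_le (p := 2) (n := B) (z := (i : ℤ) ^ (2 ^ B * w) - 1)).1
      (by exact_mod_cast h2)
    exact_mod_cast this
  rw [h1, padicNorm.mul, padicNorm.mul, padicNorm_odd_zpow hi', one_mul]
  calc _ ≤ 1 * padicNorm 2 (((i : ℤ) ^ (2 ^ B * w) - 1 : ℤ) : ℚ) := by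
        gcongr
        · exact padicNorm.nonneg _
        · exact padicNorm.of_nat _
    _ ≤ _ := by rwa [one_mul]

theorem le_padicValRat_partialStirling_iff {B κ w t : ℕ} {k : ℤ} (hk : (κ : ℤ) = k + 2 ^ B * w)
    (ht : t ≤ B) {j : ℕ} (hj : 1 ≤ j) :
    (t : ℤ) ≤ padicValRat 2 (partialStirling j k) ↔ (2 : ℤ) ^ t ∣ oddSum 1 j 0 κ := by
  have h1 : (t : ℤ) ≤ padicValRat 2 (partialStirling j k) ↔
      padicNorm 2 (partialStirling j k) ≤ 2 ^ (-(t : ℤ)) := by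
    rw [padicNorm.eq_zpow_of_nonzero (partialStirling_pos hj k).ne']
    push_cast
    rw [zpow_le_zpow_iff_right₀ (by norm_num)]
    omega
  have h2 : (2 : ℤ) ^ t ∣ oddSum 1 j 0 κ ↔ padicNorm 2 (partialStirling j κ) ≤ 2 ^ (-(t : ℤ)) := by
    rw [partialStirling_natCast]
    have := padicNorm.dvd_iff_norm_le (p := 2) (n := t) (z := oddSum 1 j 0 κ)
    exact_mod_cast this
  have h3 : padicNorm 2 (partialStirling j κ - partialStirling j k) ≤ 2 ^ (-(t : ℤ)) :=
    (padicNorm_partialStirling_sub_le hk j).trans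
      (zpow_le_zpow_right₀ (by norm_num) (by omega))
  rw [h1, h2]
  constructor <;> intro h
  · have := padicNorm.nonarchimedean (p := 2) (q := partialStirling j κ - partialStirling j k)
      (r := partialStirling j k)
    rw [sub_add_cancel] at this
    exact this.trans (max_le h3 h)
  · have := padicNorm.sub (p := 2) (q := partialStirling j κ)
      (r := partialStirling j κ - partialStirling j k)
    rw [sub_sub_cancel] at this
    exact this.trans (max_le h h3)

/-- Lower bounds for the minimal valuation, in terms of a natural exponent `κ` close to `k`. -/
theorem le_minVal_iff {B κ w t n : ℕ} {k : ℤ} (hk : (κ : ℤ) = k + 2 ^ B * w) (ht : t ≤ B)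
    (hn : 1 ≤ n) : (t : ℤ) ≤ minVal k n ↔
      ∀ c, (2 : ℤ) ^ t ∣ oddSum 0 n c κ ∧ (2 : ℤ) ^ t ∣ oddSum 1 n c κ := by
  rw [← forall_dvd_oddSum_iff]
  have h := minVal_isLeast k hn
  constructor
  · intro h1 j hj
    exact (le_padicValRat_partialStirling_iff hk ht (hn.trans hj)).1 (h1.trans (h.2 ⟨j, hj, rfl⟩))
  · intro h1
    obtain ⟨j, hj, hv⟩ := h.1
    rw [hv]
    exact (le_padicValRat_partialStirling_iff hk ht (hn.trans hj)).2 (h1 j hj)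

/-! ### Common divisors for `j ≥ 2 ^ (h + 1)` -/

/-- The even half sums force the exponent to be 2-adically close to `κ`. -/
theorem lt_of_two_pow_dvd_oddSum_zero {h b q κ c : ℕ} (hh : 1 ≤ h) (hq : Odd q)
    (hκ : κ < 2 ^ (h + 1))
    (hdvd : (2 : ℤ) ^ (κ + 2 ^ h) ∣ oddSum 0 (2 ^ (h + 1)) c (κ + 2 ^ (h + b) * q)) :
    κ + 2 ^ h < 2 ^ (h + 1) + b := by
  by_contra! hle
  have hn : 0 < 2 ^ (h + 1) := by positivity
  have h1 : (2 : ℤ) ^ (κ + 2 ^ h) ∣ oddSum 0 (2 ^ (h + 1)) c κ := by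
    rw [oddSum_zero_eq_of_lt hκ, two_pow_dvd_two_pow_mul_iff]
    exact two_pow_dvd_intSum_one h _ _
  have h2 := (oddSum_zero_add_modEq (b := b) hh hq c κ).dvd
  have h3 := (dvd_sub_left ((pow_dvd_pow 2 hle).trans hdvd)).1 h2
  have h4 := (dvd_add_right ((pow_dvd_pow 2 hle).trans h1)).1 h3
  have := not_two_pow_succ_dvd_two_pow (2 ^ (h + 1) + b - 1)
  rw [Nat.sub_add_cancel (by omega)] at this
  exact this h4

theorem two_pow_dvd_oddSum_one_add_iff {h b d κ c t : ℕ} (hh : 1 ≤ h)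
    (hd : 2 ^ (h + b) ∣ d) (hκ : κ < 2 ^ (h + 1)) (ht : κ + t ≤ 2 ^ (h + 1) + b) :
    (2 : ℤ) ^ (κ + t) ∣ oddSum 1 (2 ^ (h + 1)) c (κ + d) ↔
      (2 : ℤ) ^ t ∣ intSum 0 (2 ^ (h + 1)) c κ := by
  rw [← two_pow_dvd_two_pow_mul_iff κ t, ← oddSum_one_eq_of_lt hκ]
  exact ((oddSum_one_add_modEq hh hd c κ).of_dvd (pow_dvd_pow 2 ht)).dvd_iff

/-- The upper bound for `j ≥ n = 2 ^ (h + 1)`. If the even half sums are divisible by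
`2 ^ (κ + n / 2)`, then `b` is so large that the odd half sums may be computed at the exponent `κ`,
where one of them is not divisible by `2 ^ (κ + n / 2 + 1)`. -/
theorem not_forall_two_pow_dvd {h b q κ : ℕ} (hh : 1 ≤ h) (hq : Odd q)
    (hκ : 2 ^ h ≤ κ) (hκ' : κ < 2 ^ (h + 1)) :
    ¬ ∀ c, (2 : ℤ) ^ (κ + 2 ^ h + 1) ∣ oddSum 0 (2 ^ (h + 1)) c (κ + 2 ^ (h + b) * q) ∧
      (2 : ℤ) ^ (κ + 2 ^ h + 1) ∣ oddSum 1 (2 ^ (h + 1)) c (κ + 2 ^ (h + b) * q) := by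
  intro hall
  have hb := lt_of_two_pow_dvd_oddSum_zero hh hq hκ'
    ((pow_dvd_pow 2 (Nat.le_succ _)).trans (hall 0).1)
  have h1 : ∀ c, (2 : ℤ) ^ (2 ^ h + 1) ∣ intSum 0 (2 ^ (h + 1)) c κ := fun c =>
    (two_pow_dvd_oddSum_one_add_iff hh (dvd_mul_right _ q) hκ' (by omega)).1
      (hall c).2
  rcases hκ.eq_or_lt with rfl | hlt
  · have h2 := intSum_zero_modEq hh 0 (2 ^ h)
    obtain ⟨u, hu, hu'⟩ := exists_odd_factorial_two_pow h
    rw [fwdDiff_iter_pow_self, hu'] at h2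
    have hle : 2 ^ h ≤ 2 ^ h + 1 := Nat.le_succ _
    have h3 := two_pow_mul_odd_modEq hu (2 ^ h - 1)
    rw [Nat.sub_add_cancel Nat.one_le_two_pow] at h3
    have h4 := (((h2.of_dvd (pow_dvd_pow 2 hle)).trans h3).dvd_iff).1
      ((pow_dvd_pow 2 hle).trans (h1 0))
    have := not_two_pow_succ_dvd_two_pow (2 ^ h - 1)
    rw [Nat.sub_add_cancel Nat.one_le_two_pow] at this
    exact this h4
  · obtain ⟨s, hs, -, c, hc⟩ := exists_intSum_zero_not_modEq hh hlt hκ'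
    have hle : (2 : ℤ) ^ (s + 1) ∣ 2 ^ (2 ^ h + 1) := pow_dvd_pow 2 (by omega)
    exact hc (((Int.modEq_zero_iff_dvd.2 (h1 (c + 1))).trans
      (Int.modEq_zero_iff_dvd.2 (h1 c)).symm).of_dvd hle)

/-- The case of equality for `j ≥ n = 2 ^ (h + 1)`. -/
theorem forall_two_pow_dvd_iff {h b q : ℕ} (hh : 2 ≤ h) (hq : Odd q) :
    (∀ c, (2 : ℤ) ^ (2 ^ (h + 1) - 1 + 2 ^ h) ∣
        oddSum 0 (2 ^ (h + 1)) c (2 ^ (h + 1) - 1 + 2 ^ (h + b) * q) ∧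
      (2 : ℤ) ^ (2 ^ (h + 1) - 1 + 2 ^ h) ∣
        oddSum 1 (2 ^ (h + 1)) c (2 ^ (h + 1) - 1 + 2 ^ (h + b) * q)) ↔ 2 ^ h ≤ b := by
  have hn : 0 < 2 ^ (h + 1) := by positivity
  constructor
  · intro hall
    have := lt_of_two_pow_dvd_oddSum_zero (by omega) hq (by omega) (hall 0).1
    omega
  · intro hb c
    constructor
    · have hle : (2 : ℤ) ^ (2 ^ (h + 1) - 1 + 2 ^ h) ∣ 2 ^ (2 ^ (h + 1) + b) :=
        pow_dvd_pow 2 (by omega)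
      refine (((oddSum_zero_add_modEq (by omega) hq c _).of_dvd hle).dvd_iff).2 ?_
      refine dvd_add ?_ (pow_dvd_pow 2 (by omega))
      rw [oddSum_zero_eq_of_lt (by omega), two_pow_dvd_two_pow_mul_iff]
      exact two_pow_dvd_intSum_one h _ _
    · rw [two_pow_dvd_oddSum_one_add_iff (by omega) (dvd_mul_right _ q) (by omega)
        (by omega)]
      obtain ⟨g, rfl⟩ := Nat.exists_eq_add_of_le' (show 1 ≤ h by omega)
      have hH : 2 ≤ 2 ^ g := by
        simpa using Nat.pow_le_pow_right (n := 2) (by norm_num) (show 1 ≤ g by omega)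
      have hN : 2 ^ (g + 1) = 2 * 2 ^ g := by rw [pow_succ]; ring
      have hn' : 2 ^ (g + 1 + 1) = 2 * 2 ^ (g + 1) := by rw [pow_succ]; ring
      have := two_pow_dvd_intSum_zero_of_gt (κ := 2 ^ (g + 1) - 1) (show 1 ≤ g by omega) (by omega)
        (by omega) c
      rwa [show 2 ^ (g + 1) + (2 ^ (g + 1) - 1) = 2 ^ (g + 1 + 1) - 1 by omega] at this

/-! ### Common divisors for `j ≥ 2 ^ (h + 1) + 1` -/

/-- The strict upper bound for `j ≥ n + 1` and `n / 2 < κ < n`. For small `b` the change of the even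
half sum dominates. For large `b`, common divisibility for `j ≥ n + 1` forces the odd half sums to
be independent of the shift, which `exists_intSum_zero_not_modEq` excludes. -/
theorem not_forall_two_pow_dvd_succ_of_lt {h b q κ : ℕ} (hh : 1 ≤ h) (hq : Odd q)
    (hκ : 2 ^ h < κ) (hκ' : κ < 2 ^ (h + 1)) :
    ¬ ∀ c, (2 : ℤ) ^ (2 ^ (h + 1) + 2 ^ h) ∣
        oddSum 0 (2 ^ (h + 1) + 1) c (κ + 2 ^ (h + b) * q) ∧
      (2 : ℤ) ^ (2 ^ (h + 1) + 2 ^ h) ∣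
        oddSum 1 (2 ^ (h + 1) + 1) c (κ + 2 ^ (h + b) * q) := by
  intro hall
  simp only [oddSum_zero_succ, oddSum_one_succ] at hall
  obtain ⟨s, hs, hdvd, c, hc⟩ := exists_intSum_zero_not_modEq hh hκ hκ'
  have hd : 2 ^ (h + b) ∣ 2 ^ (h + b) * q := dvd_mul_right _ _
  have hn : 0 < 2 ^ (h + 1) := by positivity
  rcases le_or_gt (2 ^ (h + 1) + b) (κ + s) with hle | hgt
  · have h1 : (2 : ℤ) ^ (2 ^ (h + 1) + b) ∣ oddSum 1 (2 ^ (h + 1)) 0 (κ + 2 ^ (h + b) * q) := by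
      rw [(oddSum_one_add_modEq hh hd 0 κ).dvd_iff, oddSum_one_eq_of_lt hκ']
      refine (pow_dvd_pow 2 hle).trans ?_
      rw [two_pow_dvd_two_pow_mul_iff]
      exact hdvd 0
    have h2 := (dvd_add_right h1).1 ((pow_dvd_pow 2 (by omega)).trans (hall 0).2)
    rw [(oddSum_zero_add_modEq hh hq 0 κ).dvd_iff] at h2
    have h3 : (2 : ℤ) ^ (2 ^ (h + 1) + b) ∣ oddSum 0 (2 ^ (h + 1)) 0 κ := by
      rw [oddSum_zero_eq_of_lt hκ']
      refine (pow_dvd_pow 2 (show 2 ^ (h + 1) + b ≤ κ + 2 ^ h by omega)).trans ?_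
      rw [two_pow_dvd_two_pow_mul_iff]
      exact two_pow_dvd_intSum_one h _ _
    have h4 := (dvd_add_right h3).1 h2
    have := not_two_pow_succ_dvd_two_pow (2 ^ (h + 1) + b - 1)
    rw [Nat.sub_add_cancel (by omega)] at this
    exact this h4
  · have h1 := dvd_sub (hall c).1 (hall c).2
    rw [show ∀ x y z : ℤ, x + y - (z + x) = y - z by intros; ring] at h1
    have h2 := (pow_dvd_pow (2 : ℤ) (show κ + (s + 1) ≤ 2 ^ (h + 1) + 2 ^ h by omega)).trans h1
    have hm : ∀ c, oddSum 1 (2 ^ (h + 1)) c (κ + 2 ^ (h + b) * q) ≡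
        2 ^ κ * intSum 0 (2 ^ (h + 1)) c κ [ZMOD 2 ^ (κ + (s + 1))] := by
      intro c
      rw [← oddSum_one_eq_of_lt hκ']
      exact (oddSum_one_add_modEq hh hd c κ).of_dvd (pow_dvd_pow 2 (by omega))
    rw [((hm (c + 1)).sub (hm c)).dvd_iff, ← mul_sub, two_pow_dvd_two_pow_mul_iff] at h2
    exact hc (Int.modEq_iff_dvd.2 h2).symm

/-- For exponents `n + d` the sums occurring for `j ≥ n + 1` have two leading terms: the value at
the exponent `n`, of valuation `n + n / 2 - 1`, and the change caused by `d`, of valuation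
`n + b - 1`. -/
theorem oddSum_one_add_oddSum_zero_modEq {h b q : ℕ} (hh : 1 ≤ h) (hq : Odd q) (c c' : ℕ)
    {t : ℕ} (ht : t ≤ 2 ^ (h + 1) + b) (ht' : t ≤ 2 ^ (h + 1) + 2 ^ h) :
    oddSum 1 (2 ^ (h + 1)) c (2 ^ (h + 1) + 2 ^ (h + b) * q) +
      oddSum 0 (2 ^ (h + 1)) c' (2 ^ (h + 1) + 2 ^ (h + b) * q) ≡
        2 ^ (2 ^ (h + 1) + 2 ^ h - 1) + 2 ^ (2 ^ (h + 1) + b - 1) [ZMOD 2 ^ t] := by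
  have h1 := (oddSum_one_add_modEq hh (dvd_mul_right (2 ^ (h + b)) q) c (2 ^ (h + 1))).of_dvd
    (pow_dvd_pow 2 ht)
  have h2 := (oddSum_zero_add_modEq hh hq c' (2 ^ (h + 1))).of_dvd (pow_dvd_pow 2 ht)
  refine (h1.add h2).trans ?_
  rw [← add_assoc]
  refine Int.ModEq.add_right _ ?_
  have heven : Even (2 ^ (h + 1)) := Nat.even_pow.2 ⟨even_two, by omega⟩
  rw [oddSum_one_eq_self heven, oddSum_zero_eq_self heven]
  have h3 : (2 : ℤ) ^ 2 ^ h ∣ intSum 0 (2 ^ (h + 1)) c (2 ^ (h + 1)) +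
      intSum 1 (2 ^ (h + 1)) (c' + 1) (2 ^ (h + 1)) - 2 ^ (2 ^ h - 1) := by
    rw [add_sub_right_comm]
    exact dvd_add (intSum_zero_self_modEq hh c).symm.dvd (two_pow_dvd_intSum_one h _ _)
  refine (Int.ModEq.of_dvd (pow_dvd_pow 2 ht') ?_).symm
  refine Int.modEq_iff_dvd.2 ?_
  have h4 := mul_dvd_mul_left ((2 : ℤ) ^ 2 ^ (h + 1)) h3
  rw [← pow_add, mul_sub, ← pow_add, ← Nat.add_sub_assoc Nat.one_le_two_pow] at h4
  obtain ⟨z, hz⟩ := h4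
  exact ⟨z, by linear_combination hz⟩

/-- The case of equality for `j ≥ n + 1`: the two leading terms have to cancel. -/
theorem forall_two_pow_dvd_succ_iff {h b q : ℕ} (hh : 1 ≤ h) (hq : Odd q) :
    (∀ c, (2 : ℤ) ^ (2 ^ (h + 1) + 2 ^ h) ∣
        oddSum 0 (2 ^ (h + 1) + 1) c (2 ^ (h + 1) + 2 ^ (h + b) * q) ∧
      (2 : ℤ) ^ (2 ^ (h + 1) + 2 ^ h) ∣
        oddSum 1 (2 ^ (h + 1) + 1) c (2 ^ (h + 1) + 2 ^ (h + b) * q)) ↔ b = 2 ^ h := by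
  simp only [oddSum_zero_succ, oddSum_one_succ]
  have hN : 0 < 2 ^ h := by positivity
  have hn : 0 < 2 ^ (h + 1) := by positivity
  have key := fun c c' t => oddSum_one_add_oddSum_zero_modEq hh hq c c' (t := t) (b := b)
  constructor
  · intro hall
    by_contra hne
    have h0 := (hall 0).2
    rcases lt_or_gt_of_ne hne with hlt | hgt
    · have h1 := ((key 0 0 _ le_rfl (by omega)).dvd_iff).1
        ((pow_dvd_pow 2 (by omega)).trans h0)
      have h2 := (dvd_add_right (pow_dvd_pow (2 : ℤ) (show 2 ^ (h + 1) + b ≤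
        2 ^ (h + 1) + 2 ^ h - 1 by omega))).1 h1
      have := not_two_pow_succ_dvd_two_pow (2 ^ (h + 1) + b - 1)
      rw [Nat.sub_add_cancel (by omega)] at this
      exact this h2
    · have h1 := ((key 0 0 _ (by omega) le_rfl).dvd_iff).1 h0
      have h2 := (dvd_add_left (pow_dvd_pow (2 : ℤ) (show 2 ^ (h + 1) + 2 ^ h ≤
        2 ^ (h + 1) + b - 1 by omega))).1 h1
      have := not_two_pow_succ_dvd_two_pow (2 ^ (h + 1) + 2 ^ h - 1)
      rw [Nat.sub_add_cancel (by omega)] at this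
      exact this h2
  · rintro rfl
    have h1 : ∀ c c', (2 : ℤ) ^ (2 ^ (h + 1) + 2 ^ h) ∣
        oddSum 1 (2 ^ (h + 1)) c (2 ^ (h + 1) + 2 ^ (h + 2 ^ h) * q) +
          oddSum 0 (2 ^ (h + 1)) c' (2 ^ (h + 1) + 2 ^ (h + 2 ^ h) * q) := by
      intro c c'
      rw [(key c c' _ le_rfl le_rfl).dvd_iff, ← two_mul, ← pow_succ',
        Nat.sub_add_cancel (by omega)]
    intro c
    exact ⟨by rw [add_comm (oddSum _ _ _ _)]; exact h1 _ _, h1 _ _⟩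

/-- In the case of equality the minimum is not larger than asserted, since two of the odd half sums
differ modulo `2 ^ (n + n / 2 + 1)`. -/
theorem not_forall_two_pow_dvd_succ {h q : ℕ} (hh : 1 ≤ h) :
    ¬ ∀ c, (2 : ℤ) ^ (2 ^ (h + 1) + 2 ^ h + 1) ∣
        oddSum 0 (2 ^ (h + 1) + 1) c (2 ^ (h + 1) + 2 ^ (h + 2 ^ h) * q) ∧
      (2 : ℤ) ^ (2 ^ (h + 1) + 2 ^ h + 1) ∣
        oddSum 1 (2 ^ (h + 1) + 1) c (2 ^ (h + 1) + 2 ^ (h + 2 ^ h) * q) := by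
  intro hall
  simp only [oddSum_zero_succ, oddSum_one_succ] at hall
  have h1 := dvd_sub (hall 0).1 (hall 0).2
  rw [show ∀ x y z : ℤ, x + y - (z + x) = y - z by intros; ring, zero_add] at h1
  have h2 := (oddSum_one_add_sub_modEq hh (dvd_mul_right (2 ^ (h + 2 ^ h)) q) 0 1
    (2 ^ (h + 1))).dvd
  have h3 := dvd_sub h1 h2
  have heven : Even (2 ^ (h + 1)) := Nat.even_pow.2 ⟨even_two, by omega⟩
  rw [show ∀ x y z w : ℤ, x - y - (x - z - (y - w)) = z - w by intros; ring,
    oddSum_one_eq_self heven, oddSum_one_eq_self heven, sub_sub_sub_cancel_right, ← mul_sub,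
    add_assoc, two_pow_dvd_two_pow_mul_iff,
    (intSum_zero_one_sub_zero_self_modEq hh).dvd_iff] at h3
  exact not_two_pow_succ_dvd_two_pow _ h3

/-! ### Reduction to natural exponents -/

/-- An integer exponent `k` agrees modulo `2 ^ B` with some `κ + 2 ^ (h + b) * q`, where `q` is odd
and `κ` lies in a prescribed window of length `2 ^ h`. -/
theorem exists_exponent (h B lo : ℕ) (hB : lo + 2 ^ h ≤ 2 ^ B) (k : ℤ) :
    ∃ κ b q w : ℕ, lo ≤ κ ∧ κ < lo + 2 ^ h ∧ Odd q ∧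
      ((κ + 2 ^ (h + b) * q : ℕ) : ℤ) = k + 2 ^ B * w := by
  have hN : (0 : ℤ) < 2 ^ h := by positivity
  have hw : (lo : ℤ) + 2 ^ h ≤ k + 2 ^ B * (k.natAbs + 1 : ℕ) := by
    have h1 : (lo : ℤ) + 2 ^ h ≤ 2 ^ B := by exact_mod_cast hB
    have h2 : (1 : ℤ) ≤ 2 ^ B := one_le_pow₀ (by norm_num)
    have h3 : -(k.natAbs : ℤ) ≤ k := by omega
    push_cast at h3 ⊢
    have h4 : |k| ≤ 2 ^ B * |k| := le_mul_of_one_le_left (abs_nonneg k) h2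
    linarith
  obtain ⟨K, hK⟩ := Int.eq_ofNat_of_zero_le
    (show 0 ≤ k + 2 ^ B * (k.natAbs + 1 : ℕ) by linarith [Int.natCast_nonneg lo])
  rw [hK] at hw
  have hK' : lo + 2 ^ h ≤ K := by exact_mod_cast hw
  have hN' : 0 < 2 ^ h := by positivity
  obtain ⟨b, q, hq, hbq⟩ := Nat.exists_eq_two_pow_mul_odd
    (Nat.div_pos (show 2 ^ h ≤ K - lo by omega) hN').ne'
  refine ⟨lo + (K - lo) % 2 ^ h, b, q, k.natAbs + 1, by omega,
    Nat.add_lt_add_left (Nat.mod_lt _ hN') _, hq, ?_⟩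
  rw [hK, pow_add, mul_assoc, ← hbq, add_assoc, Nat.mod_add_div]
  congr 1
  omega

theorem two_pow_mul_odd_modEq_two_pow_iff {q s t : ℕ} (hq : Odd q) :
    (2 : ℤ) ^ s * q ≡ 2 ^ t [ZMOD 2 ^ (t + 1)] ↔ s = t := by
  have hq' : Odd (q : ℤ) := by exact_mod_cast hq
  constructor
  · intro h
    rcases lt_trichotomy s t with hlt | heq | hgt
    · have h1 := (two_pow_mul_odd_modEq hq' s).symm.trans
        (h.of_dvd (pow_dvd_pow 2 (show s + 1 ≤ t + 1 by omega)))
      exact absurd (h1.dvd_iff.2 (pow_dvd_pow 2 (show s + 1 ≤ t from hlt)))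
        (not_two_pow_succ_dvd_two_pow s)
    · exact heq
    · exact absurd (h.dvd_iff.1 ((pow_dvd_pow 2 hgt).mul_right _)) (not_two_pow_succ_dvd_two_pow t)
  · rintro rfl
    exact two_pow_mul_odd_modEq hq' s

theorem two_pow_dvd_two_pow_mul_odd_iff {q s t : ℕ} (hq : Odd q) :
    (2 : ℤ) ^ t ∣ 2 ^ s * q ↔ t ≤ s := by
  have hq' : Odd (q : ℤ) := by exact_mod_cast hq
  refine ⟨fun h => ?_, fun h => (pow_dvd_pow 2 h).mul_right _⟩
  by_contra! hlt
  exact not_two_pow_succ_dvd_two_pow s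
    ((two_pow_mul_odd_modEq hq' s).dvd_iff.1 ((pow_dvd_pow 2 hlt).trans h))

/-! ### The two minima -/

theorem minVal_two_pow {h : ℕ} (hh : 2 ≤ h) (k : ℤ) :
    minVal k (2 ^ (h + 1)) ≤ 2 ^ (h + 1) + 2 ^ h - 1 ∧
      (minVal k (2 ^ (h + 1)) = 2 ^ (h + 1) + 2 ^ h - 1 ↔
        k ≡ 2 ^ (h + 1) - 1 [ZMOD 2 ^ (2 ^ h + h)]) := by
  have hn : 2 ^ (h + 1) = 2 * 2 ^ h := by rw [pow_succ]; ring
  have hN : 0 < 2 ^ h := by positivity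
  have hhN : h < 2 ^ h := Nat.lt_two_pow_self
  set B := 2 ^ (h + 1) + 2 ^ h with hB
  have hB2 : 2 ^ h + 2 ^ h ≤ 2 ^ B := by
    rw [← two_mul, ← hn]
    exact Nat.pow_le_pow_right (by norm_num) (by omega)
  obtain ⟨κ, b, q, w, hκ, hκ', hq, hk⟩ := exists_exponent h B (2 ^ h) hB2 k
  have hκn : κ < 2 ^ (h + 1) := by omega
  have hpos : 1 ≤ 2 ^ (h + 1) := Nat.one_le_two_pow
  have key := fun t (ht : t ≤ B) => le_minVal_iff hk ht hpos
  have hlt : ¬ ((κ + 2 ^ h + 1 : ℕ) : ℤ) ≤ minVal k (2 ^ (h + 1)) := by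
    rw [key _ (by omega)]
    exact not_forall_two_pow_dvd (by omega) hq hκ hκn
  have hM : ((2 ^ (h + 1) - 1 + 2 ^ h : ℕ) : ℤ) = 2 ^ (h + 1) + 2 ^ h - 1 := by
    rw [Nat.cast_add, Nat.cast_sub hpos]
    push_cast
    ring
  have hcongr : k ≡ 2 ^ (h + 1) - 1 [ZMOD 2 ^ (2 ^ h + h)] ↔
      (2 : ℤ) ^ (2 ^ h + h) ∣ (κ - (2 ^ (h + 1) - 1)) + 2 ^ (h + b) * q := by
    rw [Int.modEq_comm, Int.modEq_iff_dvd, show k = κ + 2 ^ (h + b) * q - 2 ^ B * w by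
      rw [eq_sub_iff_add_eq, ← hk]; push_cast; ring, sub_right_comm, sub_eq_add_neg _ (2 ^ B * _),
      dvd_add_left (((pow_dvd_pow 2 (by omega)).mul_right _).neg_right), add_sub_right_comm]
  rw [← hM, hcongr]
  -- below the end of the window `κ` is not congruent to `n - 1` modulo `2 ^ h`
  rcases (show κ + 1 < 2 ^ (h + 1) ∨ κ = 2 ^ (h + 1) - 1 by omega) with hκ1 | rfl
  · refine ⟨by omega, fun h1 => by omega, fun h1 => ?_⟩
    exfalso
    have h2 : (2 : ℤ) ^ h ∣ κ - (2 ^ (h + 1) - 1) :=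
      (dvd_add_left ((pow_dvd_pow 2 (by omega)).mul_right _)).1
        ((pow_dvd_pow 2 (by omega)).trans h1)
    have h3 := Int.le_of_dvd (by
      have : (κ : ℤ) + 1 < 2 ^ (h + 1) := by exact_mod_cast hκ1
      linarith) ((dvd_neg).2 h2)
    have h4 : ((2 ^ h : ℕ) : ℤ) ≤ κ := by exact_mod_cast hκ
    have h5 : (2 : ℤ) ^ (h + 1) = 2 * 2 ^ h := by rw [pow_succ]; ring
    push_cast at h4
    linarith
  · have h1 := (key _ (show 2 ^ (h + 1) - 1 + 2 ^ h ≤ B by omega)).trans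
      (forall_two_pow_dvd_iff hh hq)
    have h2 : ((2 ^ (h + 1) - 1 : ℕ) : ℤ) - (2 ^ (h + 1) - 1) = 0 := by
      rw [Nat.cast_sub hpos]
      push_cast
      ring
    rw [h2, zero_add, two_pow_dvd_two_pow_mul_odd_iff hq,
      show 2 ^ h + h ≤ h + b ↔ 2 ^ h ≤ b by omega, ← h1]
    omega

theorem minVal_two_pow_add_one {h : ℕ} (hh : 1 ≤ h) (k : ℤ) :
    minVal k (2 ^ (h + 1) + 1) ≤ 2 ^ (h + 1) + 2 ^ h ∧
      (minVal k (2 ^ (h + 1) + 1) = 2 ^ (h + 1) + 2 ^ h ↔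
        k ≡ 2 ^ (h + 1) + 2 ^ (2 ^ h + h) [ZMOD 2 ^ (2 ^ h + h + 1)]) := by
  have hn : 2 ^ (h + 1) = 2 * 2 ^ h := by rw [pow_succ]; ring
  have hN : 0 < 2 ^ h := by positivity
  have hhN : h < 2 ^ h := Nat.lt_two_pow_self
  set B := 2 ^ (h + 1) + 2 ^ h + 1 with hB
  have hB2 : 2 ^ h + 1 + 2 ^ h ≤ 2 ^ B := by
    have : 2 ^ (h + 2) ≤ 2 ^ B := Nat.pow_le_pow_right (by norm_num) (by omega)
    rw [pow_succ, hn] at this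
    omega
  obtain ⟨κ, b, q, w, hκ, hκ', hq, hk⟩ := exists_exponent h B (2 ^ h + 1) hB2 k
  have key := fun t (ht : t ≤ B) => le_minVal_iff hk ht (show 1 ≤ 2 ^ (h + 1) + 1 by omega)
  have hM : ((2 ^ (h + 1) + 2 ^ h : ℕ) : ℤ) = 2 ^ (h + 1) + 2 ^ h := by push_cast; ring
  have hcongr : k ≡ 2 ^ (h + 1) + 2 ^ (2 ^ h + h) [ZMOD 2 ^ (2 ^ h + h + 1)] ↔
      (κ - 2 ^ (h + 1)) + 2 ^ (h + b) * q ≡ 2 ^ (2 ^ h + h) [ZMOD 2 ^ (2 ^ h + h + 1)] := by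
    have hd : (2 : ℤ) ^ (2 ^ h + h + 1) ∣ 2 ^ B * w := (pow_dvd_pow 2 (by omega)).mul_right _
    have hk' : k = κ + 2 ^ (h + b) * q - 2 ^ B * w := by
      rw [eq_sub_iff_add_eq, ← hk]; push_cast; ring
    rw [Int.modEq_comm, Int.modEq_iff_dvd, Int.modEq_comm, Int.modEq_iff_dvd, hk',
      show ∀ x y z u v : ℤ, x + y - z - (u + v) = x - u + y - v - z by intros; ring,
      dvd_sub_left hd]
  rw [← hM, hcongr]
  -- below the end of the window `κ` is not divisible by `2 ^ h`
  rcases (show κ < 2 ^ (h + 1) ∨ κ = 2 ^ (h + 1) by omega) with hκ1 | rfl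
  · have hlt := (key _ (show 2 ^ (h + 1) + 2 ^ h ≤ B by omega)).not.2
      (not_forall_two_pow_dvd_succ_of_lt hh hq (by omega) hκ1)
    refine ⟨by omega, fun h1 => by omega, fun h1 => ?_⟩
    exfalso
    have h1' := h1.of_dvd (pow_dvd_pow 2 (show h ≤ 2 ^ h + h + 1 by omega))
    have h2 : (2 : ℤ) ^ h ∣ κ - 2 ^ (h + 1) :=
      (dvd_add_left ((pow_dvd_pow 2 (by omega)).mul_right _)).1
        (h1'.dvd_iff.2 (pow_dvd_pow 2 (by omega)))
    have h3 := Int.le_of_dvd (by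
      have : (κ : ℤ) < 2 ^ (h + 1) := by exact_mod_cast hκ1
      linarith) ((dvd_neg).2 h2)
    have h4 : ((2 ^ h + 1 : ℕ) : ℤ) ≤ κ := by exact_mod_cast hκ
    have h5 : (2 : ℤ) ^ (h + 1) = 2 * 2 ^ h := by rw [pow_succ]; ring
    push_cast at h4
    linarith
  · have h1 := (key _ (show 2 ^ (h + 1) + 2 ^ h ≤ B by omega)).trans
      (forall_two_pow_dvd_succ_iff hh hq)
    have h2 : ((2 ^ (h + 1) : ℕ) : ℤ) - 2 ^ (h + 1) = 0 := by push_cast; ring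
    rw [h2, zero_add, two_pow_mul_odd_modEq_two_pow_iff hq,
      show h + b = 2 ^ h + h ↔ b = 2 ^ h by omega, ← h1]
    have h3 : ¬ ((2 ^ (h + 1) + 2 ^ h + 1 : ℕ) : ℤ) ≤ minVal k (2 ^ (h + 1) + 1) := by
      intro hle
      obtain rfl := h1.1 (by omega)
      exact not_forall_two_pow_dvd_succ hh ((key _ le_rfl).1 hle)
    omega

end

theorem theorem1p1 :
    (∀ e : ℕ, 3 ≤ e → ∀ k : ℤ,
      minVal k (2 ^ e) ≤ 2 ^ e + 2 ^ (e - 1) - 1 ∧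
      (minVal k (2 ^ e) = 2 ^ e + 2 ^ (e - 1) - 1 ↔
        k ≡ 2 ^ e - 1 [ZMOD 2 ^ (2 ^ (e - 1) + e - 1)])) ∧
    (∀ e : ℕ, 2 ≤ e → ∀ k : ℤ,
      minVal k (2 ^ e + 1) ≤ 2 ^ e + 2 ^ (e - 1) ∧
      (minVal k (2 ^ e + 1) = 2 ^ e + 2 ^ (e - 1) ↔
        k ≡ 2 ^ e + 2 ^ (2 ^ (e - 1) + e - 1) [ZMOD 2 ^ (2 ^ (e - 1) + e)])) := by
  constructor
  · intro e he k
    obtain ⟨h, rfl⟩ := Nat.exists_eq_add_of_le' (show 1 ≤ e by omega)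
    exact minVal_two_pow (by omega) k
  · intro e he k
    obtain ⟨h, rfl⟩ := Nat.exists_eq_add_of_le' (show 1 ≤ e by omega)
    exact minVal_two_pow_add_one (by omega) k
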